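/- Let $V=\mathbb{R}^n$ and let $W$ be a finite real reflection group acting on $V$, i.e. a finite subgroup $W\subset GL(V)$ generated by reflections (elements $w$ whose fixed space $V^w=\{x\in V: w(x)=x\}$ is a linear hyperplane). Let $\mathcal{A}_W$ be the arrangement of all hyperplanes $V^w$ with $w\in W$ a reflection, and let $\mathcal{L}(\mathcal{A}_W)$ be the poset of all intersections of subsets of $\mathcal{A}_W$ (with $V$ as the empty intersection), ordered by reverse inclusion, with Möbius function $\mu$. Let $\mathcal{K}$ be a cone of $\mathcal{A}_W$, i.e. a nonempty intersection of (possibly no) open halfspaces bounded by hyperplanes of $\mathcal{A}_W$. Put $$\mathcal{L}^{\mathrm{int}}(\mathcal{K})=\{X\in\mathcal{L}(\mathcal{A}_W): X\cap\mathcal{K}\neq\varnothing\},\qquad W^{\pitchfork}(\mathcal{K})=\{w\in W: V^w\in\mathcal{L}^{\mathrm{int}}(\mathcal{K})\},$$ $$c_k(\mathcal{K})=\sum_{X\in\mathcal{L}^{\mathrm{int}}(\mathcal{K}),\ n-\dim X=k}|\mu(V,X)|,\qquad \mathrm{Poin}(\mathcal{K},t)=\sum_{k=0}^{n}c_k(\mathcal{K})\,t^k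 .$$ Then $$\mathrm{Poin}(\mathcal{K},t)=\sum_{w\in W^{\pitchfork}(\mathcal{K})}t^{\,n-\dim V^w}.$$ Moreover, the number of chambers of $\mathcal{A}_W$ (connected components of $V\setminus\bigcup_{H\in\mathcal{A}_W}H$) contained in $\mathcal{K}$ is finite and equals $\#W^{\pitchfork}(\mathcal{K})$. -/

import Mathlib

/-- A finite arrangement of linear hyperplanes in a real vector space `V`. -/
structure HyperplaneArrangement (V : Type*) [AddCommGroup V] [Module ℝ V] where
  /-- the hyperplanes of the arrangement -/
  hyperplanes : Finset (Submodule ℝ V)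
  finrank_add_one : ∀ H ∈ hyperplanes, Module.finrank ℝ H + 1 = Module.finrank ℝ V

namespace HyperplaneArrangement

variable {V : Type*} [AddCommGroup V] [Module ℝ V] (A : HyperplaneArrangement V)

/-- The set of all intersections `H₁ ∩ ⋯ ∩ Hₖ` of hyperplanes of `A`; the empty intersection
is the whole space `V`. -/
def intersections : Set (Submodule ℝ V) :=
  {X | ∃ B : Finset (Submodule ℝ V), B ⊆ A.hyperplanes ∧ X = B.inf id}

theorem top_mem_intersections : (⊤ : Submodule ℝ V) ∈ A.intersections :=
  ⟨∅, by simp, by simp⟩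

theorem finite_intersections : A.intersections.Finite := by
  refine (A.hyperplanes.powerset.finite_toSet.image fun B => B.inf id).subset ?_
  rintro X ⟨B, hB, rfl⟩
  exact ⟨B, by simpa using hB, rfl⟩

/-- The intersection poset of `A`: its intersections, ordered by reverse inclusion. -/
abbrev IntersectionPoset : Type _ := (↥A.intersections)ᵒᵈ

noncomputable instance fintypeIntersections : Fintype ↥A.intersections :=
  A.finite_intersections.fintype

open Classical in
noncomputable instance locallyFiniteOrderIntersectionPoset :
    LocallyFiniteOrder A.IntersectionPoset :=
  Fintype.toLocallyFiniteOrder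

/-- The bottom element `V` of the intersection poset. -/
def bottom : A.IntersectionPoset := OrderDual.toDual ⟨⊤, A.top_mem_intersections⟩

open Classical in
/-- The Möbius function value `μ(V, X)` of the intersection poset. -/
noncomputable def moebius (X : ↥A.intersections) : ℤ :=
  IncidenceAlgebra.mu ℤ A.bottom (OrderDual.toDual X)

/-- `S` is one of the two open halfspaces bounded by the hyperplane `H`. -/
def IsOpenHalfspace (H : Submodule ℝ V) (S : Set V) : Prop :=
  ∃ f : V →ₗ[ℝ] ℝ, LinearMap.ker f = H ∧ S = {x | 0 < f x}

/-- A cone of `A`: a nonempty intersection of open halfspaces bounded by hyperplanes of `A`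
(the empty intersection being `V`). -/
def IsCone (K : Set V) : Prop :=
  K.Nonempty ∧ ∃ 𝒮 : Set (Set V),
    (∀ S ∈ 𝒮, ∃ H ∈ A.hyperplanes, IsOpenHalfspace H S) ∧ K = ⋂₀ 𝒮

/-- The interior intersections of `K`: the intersections of `A` that meet `K`. -/
def interiorIntersections (K : Set V) : Set (Submodule ℝ V) :=
  {X | X ∈ A.intersections ∧ ((X : Set V) ∩ K).Nonempty}

open Classical in
/-- The `k`-th signless Whitney number of `K`: the sum of `|μ(V, X)|` over the interior
intersections `X` of `K` that have codimension `k`. -/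
noncomputable def whitney (K : Set V) (k : ℕ) : ℕ :=
  ∑ X ∈ Finset.univ.filter (fun X : ↥A.intersections =>
      (X : Submodule ℝ V) ∈ A.interiorIntersections K ∧
        Module.finrank ℝ V - Module.finrank ℝ (X : Submodule ℝ V) = k),
    (A.moebius X).natAbs

/-- The Poincaré polynomial of `K`. -/
noncomputable def poincare (K : Set V) : Polynomial ℕ :=
  ∑ k ∈ Finset.range (Module.finrank ℝ V + 1),
    Polynomial.C (A.whitney K k) * Polynomial.X ^ k

/-- The complement of the union of the hyperplanes of `A`. -/
def complement : Set V := (⋃ H ∈ A.hyperplanes, (H : Set V))ᶜ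

/-- The chambers of `A`: the connected components of the complement. -/
def chambers [TopologicalSpace V] : Set (Set V) :=
  {C | ∃ x ∈ A.complement, C = connectedComponentIn A.complement x}

/-- The chambers of `A` that lie inside `K`. -/
def chambersIn [TopologicalSpace V] (K : Set V) : Set (Set V) :=
  {C | C ∈ A.chambers ∧ C ⊆ K}

end HyperplaneArrangement

namespace RealReflectionGroup

variable {V : Type*} [AddCommGroup V] [Module ℝ V]

/-- The fixed space `V^w = {x | w x = x}`. -/
def fixedSpace (w : V ≃ₗ[ℝ] V) : Submodule ℝ V :=
  LinearMap.eqLocus (w : V →ₗ[ℝ] V) LinearMap.id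

/-- A reflection: a linear automorphism whose fixed space is a hyperplane. -/
def IsReflection (w : V ≃ₗ[ℝ] V) : Prop :=
  Module.finrank ℝ (fixedSpace w) + 1 = Module.finrank ℝ V

/-- `W` is generated by the reflections that it contains. -/
def IsGeneratedByReflections (W : Subgroup (V ≃ₗ[ℝ] V)) : Prop :=
  Subgroup.closure {w | w ∈ W ∧ IsReflection w} = W

theorem finite_reflectingHyperplanes (W : Subgroup (V ≃ₗ[ℝ] V)) [Finite W] :
    {H : Submodule ℝ V | ∃ w ∈ W, IsReflection w ∧ fixedSpace w = H}.Finite := by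
  refine (Set.finite_range fun w : W => fixedSpace (w : V ≃ₗ[ℝ] V)).subset ?_
  rintro H ⟨w, hw, -, rfl⟩
  exact ⟨⟨w, hw⟩, rfl⟩

/-- The reflection arrangement of a finite group `W`: the fixed spaces of its reflections. -/
noncomputable def reflectionArrangement (W : Subgroup (V ≃ₗ[ℝ] V)) [Finite W] :
    HyperplaneArrangement V where
  hyperplanes := (finite_reflectingHyperplanes W).toFinset
  finrank_add_one := by
    intro H hH
    obtain ⟨w, -, hw, rfl⟩ := (finite_reflectingHyperplanes W).mem_toFinset.1 hH
    exact hw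

/-- The elements `w` of `W` whose fixed space is an interior intersection of `K`. -/
def transverseElements (W : Subgroup (V ≃ₗ[ℝ] V)) [Finite W] (K : Set V) : Set W :=
  {w | fixedSpace (w : V ≃ₗ[ℝ] V) ∈ (reflectionArrangement W).interiorIntersections K}

end RealReflectionGroup

/-! Everything rests on `moebius_eq_sum`: μ(V, X) is (-1)^codim X times the number of w in W with
V^w = X. Hence |μ(V, X)| counts group elements, and grouping the transverse elements by fixed space
gives the polynomial identity.

For w of finite order, det w = (-1)^codim V^w (`LinearMap.det_of_pow_eq_one`). Sum these signs over
all w with V^w ⊇ Y. If Y lies in the hyperplane of a reflection t, then w ↦ tw is a sign-reversing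
permutation and the sum is 0; if Y = V, only the identity contributes. This is the recursion
defining μ, once each V^w is known to be an intersection of reflecting hyperplanes
(`fixedSpace_mem_intersections`). That follows from Steinberg's theorem: an element fixing q is a
product of reflections fixing q. The proof uses galleries: the product of the reflections crossed
depends only on the end regions (`Gallery.unique`), it equals w when the gallery runs from x to w x
(`Gallery.eq_of_closure`), and a gallery can be chosen to cross only hyperplanes separating its
ends. No invariant inner product is used; finite order replaces it.

Chambers are counted by a Zaslavsky formula (`ncard_regular_faces`): Euler characteristics of the
sets X ∩ K are computed from faces, and Möbius summation isolates the open faces. The count becomes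
the sum of |μ(V, X)| over interior X. -/

section Forms

variable {V : Type*} [AddCommGroup V] [Module ℝ V]

theorem Submodule.exists_ker_eq_of_finrank_add_one [FiniteDimensional ℝ V] (H : Submodule ℝ V)
    (h : Module.finrank ℝ H + 1 = Module.finrank ℝ V) : ∃ f : V →ₗ[ℝ] ℝ, LinearMap.ker f = H := by
  have h1 : Module.finrank ℝ (V ⧸ H) = Module.finrank ℝ ℝ := by
    have := H.finrank_quotient_add_finrank
    rw [Module.finrank_self]
    omega
  refine ⟨(LinearEquiv.ofFinrankEq _ _ h1).toLinearMap ∘ₗ H.mkQ, ?_⟩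
  rw [LinearMap.ker_comp, LinearEquiv.ker, Submodule.comap_bot, Submodule.ker_mkQ]

open Classical in
/-- A linear form with kernel `H`, for a hyperplane `H`. -/
noncomputable def Submodule.form (H : Submodule ℝ V) : V →ₗ[ℝ] ℝ :=
  if h : ∃ f : V →ₗ[ℝ] ℝ, LinearMap.ker f = H then h.choose else 0

theorem Submodule.ker_form [FiniteDimensional ℝ V] (H : Submodule ℝ V)
    (h : Module.finrank ℝ H + 1 = Module.finrank ℝ V) : LinearMap.ker H.form = H := by
  have h1 := H.exists_ker_eq_of_finrank_add_one h
  rw [Submodule.form, dif_pos h1]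
  exact h1.choose_spec

theorem LinearMap.exists_eq_smul_of_ker_eq {f g : V →ₗ[ℝ] ℝ}
    (h : LinearMap.ker f = LinearMap.ker g) : ∃ c : ℝ, c ≠ 0 ∧ ∀ x, f x = c * g x := by
  have key : ∀ x, g x = 0 ↔ f x = 0 := fun x => by
    rw [← LinearMap.mem_ker, ← h, LinearMap.mem_ker]
  by_cases hg : ∀ x, g x = 0
  · exact ⟨1, one_ne_zero, fun x => by rw [hg x, (key x).1 (hg x), mul_zero]⟩
  push Not at hg
  obtain ⟨e, he⟩ := hg
  refine ⟨f e / g e, div_ne_zero (fun h => he ((key e).2 h)) he, fun x => ?_⟩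
  have h1 : g (x - (g x / g e) • e) = 0 := by
    rw [map_sub, map_smul, smul_eq_mul, div_mul_cancel₀ _ he, sub_self]
  have h2 := (key _).1 h1
  rw [map_sub, map_smul, smul_eq_mul, sub_eq_zero] at h2
  rw [h2]
  field_simp

end Forms

/-! ### Reflections of finite order and the hyperplanes separating two points -/

namespace RealReflectionGroup

variable {V : Type*} [AddCommGroup V] [Module ℝ V]

theorem mem_fixedSpace {w : V ≃ₗ[ℝ] V} {x : V} : x ∈ fixedSpace w ↔ w x = x := Iff.rfl

/-- The k-th power of a transvection multiplies its displacement by k, so over ℝ finite order forces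
the displacement to vanish. -/
theorem smul_eq_zero_of_transvection {g : V ≃ₗ[ℝ] V} (hg : IsOfFinOrder g) {f : V →ₗ[ℝ] ℝ} {u : V}
    (h : ∀ x, g x = x + f x • u) (hu : f u = 0) (x : V) : f x • u = 0 := by
  have h1 : ∀ k : ℕ, (g ^ k) x = x + (k : ℝ) • f x • u := by
    intro k
    induction k with
    | zero => simp
    | succ k ih =>
      rw [pow_succ', LinearEquiv.mul_apply, ih, h]
      simp only [map_add, map_smul, hu, smul_zero, add_zero, Nat.cast_succ]
      module
  obtain ⟨k, hk, h2⟩ := hg.exists_pow_eq_one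
  have h3 := h1 k
  rw [h2, LinearEquiv.coe_one, id, left_eq_add] at h3
  exact (smul_eq_zero.1 h3).resolve_left (by exact_mod_cast hk.ne')

/-- The map t scales f by 1 + f v. Finite order makes this factor ±1, and +1 would make t a
transvection, hence trivial. This is where t becomes an involution. -/
theorem IsReflection.exists_form [FiniteDimensional ℝ V] {t : V ≃ₗ[ℝ] V} (ht : IsReflection t)
    (hfin : IsOfFinOrder t) {f : V →ₗ[ℝ] ℝ} (hf : LinearMap.ker f = fixedSpace t) :
    ∃ v, f v = -2 ∧ ∀ x, t x = x + f x • v := by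
  have hne : ∃ e, f e = 1 := by
    by_contra! hcon
    have : f = 0 := by
      ext x
      by_contra hx
      refine hcon ((f x)⁻¹ • x) ?_
      rw [map_smul, smul_eq_mul]
      exact inv_mul_cancel₀ hx
    have h1 : Module.finrank ℝ (fixedSpace t) + 1 = Module.finrank ℝ V := ht
    rw [← hf, this, LinearMap.ker_zero, finrank_top] at h1
    omega
  obtain ⟨e, he⟩ := hne
  have ht1 : ∀ x, t x = x + f x • (t e - e) := by
    intro x
    have h1 : x - f x • e ∈ fixedSpace t := by
      rw [← hf, LinearMap.mem_ker, map_sub, map_smul, he, smul_eq_mul, mul_one, sub_self]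
    rw [mem_fixedSpace, map_sub, map_smul, sub_eq_iff_eq_add] at h1
    rw [h1]
    module
  generalize t e - e = v at ht1
  refine ⟨v, ?_, ht1⟩
  have h1 : ∀ x, f (t x) = (1 + f v) * f x := fun x => by
    rw [ht1, map_add, map_smul, smul_eq_mul]
    ring
  have h2 : ∀ (k : ℕ) x, f ((t ^ k) x) = (1 + f v) ^ k * f x := by
    intro k x
    induction k with
    | zero => simp
    | succ k ih => rw [pow_succ', LinearEquiv.mul_apply, h1, ih]; ring
  obtain ⟨k, hk, hk1⟩ := hfin.exists_pow_eq_one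
  have h3 := h2 k e
  rw [hk1, LinearEquiv.coe_one, id, he, mul_one] at h3
  have h4 : |1 + f v| = 1 := by
    refine (pow_eq_one_iff_of_nonneg (abs_nonneg _) hk.ne').1 ?_
    rw [← abs_pow, ← h3, abs_one]
  rcases (abs_eq zero_le_one).1 h4 with h5 | h5
  · exfalso
    have h6 := smul_eq_zero_of_transvection hfin ht1 (by linarith) e
    have h7 := ht1 e
    rw [h6, add_zero] at h7
    have : e ∈ LinearMap.ker f := by rw [hf]; exact h7
    rw [LinearMap.mem_ker, he] at this
    exact one_ne_zero this
  · linarith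

/-- The reflections in `W`. -/
def reflections (W : Subgroup (V ≃ₗ[ℝ] V)) : Set (V ≃ₗ[ℝ] V) := {t | t ∈ W ∧ IsReflection t}

/-- The form defining the hyperplane of a reflection. -/
noncomputable def refForm (t : V ≃ₗ[ℝ] V) : V →ₗ[ℝ] ℝ := (fixedSpace t).form

/-- The points on no reflecting hyperplane of `W`. -/
def regularPoints (W : Subgroup (V ≃ₗ[ℝ] V)) : Set V := {x | ∀ t ∈ reflections W, t x ≠ x}

/-- The hyperplane of the reflection `t` separates `x` and `y`. -/
def Separates (t : V ≃ₗ[ℝ] V) (x y : V) : Prop := refForm t x * refForm t y < 0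

theorem Separates.symm {t : V ≃ₗ[ℝ] V} {x y : V} (h : Separates t x y) : Separates t y x := by
  rwa [Separates, mul_comm]

theorem separates_comm {t : V ≃ₗ[ℝ] V} {x y : V} : Separates t x y ↔ Separates t y x :=
  ⟨Separates.symm, Separates.symm⟩

section Finite

variable [FiniteDimensional ℝ V] {W : Subgroup (V ≃ₗ[ℝ] V)} [Finite W]

omit [FiniteDimensional ℝ V] in
theorem isOfFinOrder_of_mem {w : V ≃ₗ[ℝ] V} (hw : w ∈ W) : IsOfFinOrder w :=
  W.subtype.isOfFinOrder (isOfFinOrder_of_finite (⟨w, hw⟩ : W))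

omit [Finite W] in
theorem ker_refForm {t : V ≃ₗ[ℝ] V} (ht : t ∈ reflections W) :
    LinearMap.ker (refForm t) = fixedSpace t :=
  Submodule.ker_form _ ht.2

omit [Finite W] in
theorem refForm_eq_zero_iff {t : V ≃ₗ[ℝ] V} (ht : t ∈ reflections W) {x : V} :
    refForm t x = 0 ↔ t x = x := by
  rw [← LinearMap.mem_ker, ker_refForm ht, mem_fixedSpace]

theorem refForm_reflection {t : V ≃ₗ[ℝ] V} (ht : t ∈ reflections W) (x : V) :
    refForm t (t x) = - refForm t x := by
  obtain ⟨v, hv, h⟩ := ht.2.exists_form (isOfFinOrder_of_mem ht.1) (ker_refForm ht)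
  rw [h, map_add, map_smul, hv, smul_eq_mul]
  ring

theorem reflection_mul_self {t : V ≃ₗ[ℝ] V} (ht : t ∈ reflections W) : t * t = 1 := by
  obtain ⟨v, hv, h⟩ := ht.2.exists_form (isOfFinOrder_of_mem ht.1) (ker_refForm ht)
  ext x
  rw [LinearEquiv.mul_apply, h (t x), refForm_reflection ht, h x, LinearEquiv.coe_one, id]
  module

theorem reflection_apply_apply {t : V ≃ₗ[ℝ] V} (ht : t ∈ reflections W) (x : V) :
    t (t x) = x := by
  rw [← LinearEquiv.mul_apply, reflection_mul_self ht, LinearEquiv.coe_one, id]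

theorem reflection_inv {t : V ≃ₗ[ℝ] V} (ht : t ∈ reflections W) : t⁻¹ = t :=
  inv_eq_of_mul_eq_one_right (reflection_mul_self ht)

/-- The product of two reflections in the same hyperplane is a transvection of finite order, hence
trivial. -/
theorem reflection_eq_of_fixedSpace_eq {s t : V ≃ₗ[ℝ] V} (hs : s ∈ reflections W)
    (ht : t ∈ reflections W) (h : fixedSpace s = fixedSpace t) : s = t := by
  have hf := ker_refForm ht
  obtain ⟨v, hv, h1⟩ := ht.2.exists_form (isOfFinOrder_of_mem ht.1) hf
  obtain ⟨u, hu, h2⟩ := hs.2.exists_form (isOfFinOrder_of_mem hs.1) (hf.trans h.symm)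
  have h3 : ∀ x, (s * t) x = x + refForm t x • (v - u) := by
    intro x
    rw [LinearEquiv.mul_apply, h2 (t x), refForm_reflection ht, h1 x]
    module
  have h4 := smul_eq_zero_of_transvection (isOfFinOrder_of_mem (W.mul_mem hs.1 ht.1)) h3
    (by rw [map_sub, hu, hv, sub_self])
  have h5 : s * t = 1 := by
    ext x
    rw [h3, h4, add_zero, LinearEquiv.coe_one, id]
  rw [← inv_inv s, ← eq_inv_of_mul_eq_one_right h5, reflection_inv ht]

omit [FiniteDimensional ℝ V] [Finite W] in
theorem fixedSpace_conj (w t : V ≃ₗ[ℝ] V) :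
    fixedSpace (w * t * w⁻¹) = (fixedSpace t).map (w : V →ₗ[ℝ] V) := by
  ext x
  rw [Submodule.mem_map]
  constructor
  · intro h
    refine ⟨w⁻¹ x, ?_, ?_⟩
    · rw [mem_fixedSpace, LinearEquiv.mul_apply, LinearEquiv.mul_apply] at h
      rw [mem_fixedSpace]
      apply w.injective
      rw [h]
      exact (w.apply_symm_apply x).symm
    · exact w.apply_symm_apply x
  · rintro ⟨y, hy, rfl⟩
    rw [mem_fixedSpace] at hy ⊢
    have : w⁻¹ (w y) = y := w.symm_apply_apply y
    simp only [LinearEquiv.mul_apply, LinearEquiv.coe_coe, this, hy]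

omit [FiniteDimensional ℝ V] [Finite W] in
theorem conj_mem_reflections {w t : V ≃ₗ[ℝ] V} (hw : w ∈ W) (ht : t ∈ reflections W) :
    w * t * w⁻¹ ∈ reflections W := by
  refine ⟨W.mul_mem (W.mul_mem hw ht.1) (W.inv_mem hw), ?_⟩
  rw [IsReflection, fixedSpace_conj, LinearEquiv.finrank_map_eq]
  exact ht.2

-- The form of the conjugate, pulled back by w, is a nonzero multiple c of the form of t; the
-- product of two values is scaled by c² > 0.
omit [Finite W] in
theorem separates_conj {w t : V ≃ₗ[ℝ] V} (hw : w ∈ W) (ht : t ∈ reflections W) {x y : V} :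
    Separates (w * t * w⁻¹) (w x) (w y) ↔ Separates t x y := by
  obtain ⟨c, hc, h⟩ : ∃ c : ℝ, c ≠ 0 ∧ ∀ x,
      (refForm (w * t * w⁻¹) ∘ₗ (w : V →ₗ[ℝ] V)) x = c * refForm t x := by
    apply LinearMap.exists_eq_smul_of_ker_eq
    rw [LinearMap.ker_comp, ker_refForm (conj_mem_reflections hw ht), fixedSpace_conj,
      ker_refForm ht, Submodule.comap_map_eq_of_injective w.injective]
  simp only [LinearMap.comp_apply, LinearEquiv.coe_coe] at h
  have h1 : refForm (w * t * w⁻¹) (w x) * refForm (w * t * w⁻¹) (w y) =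
      c ^ 2 * (refForm t x * refForm t y) := by
    rw [h, h]
    ring
  rw [Separates, Separates, h1]
  have h2 : 0 < c ^ 2 := by positivity
  simp [mul_neg_iff, h2, h2.not_gt]

omit [FiniteDimensional ℝ V] [Finite W] in
theorem apply_mem_regularPoints {w : V ≃ₗ[ℝ] V} (hw : w ∈ W) {x : V} (hx : x ∈ regularPoints W) :
    w x ∈ regularPoints W := by
  intro t ht h
  have h1 := conj_mem_reflections (W.inv_mem hw) ht
  refine hx _ h1 ?_
  rw [inv_inv, LinearEquiv.mul_apply, LinearEquiv.mul_apply, h]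
  exact w.symm_apply_apply x

omit [Finite W] in
theorem refForm_ne_zero {t : V ≃ₗ[ℝ] V} (ht : t ∈ reflections W) {x : V}
    (hx : x ∈ regularPoints W) : refForm t x ≠ 0 :=
  fun h => hx t ht ((refForm_eq_zero_iff ht).1 h)

omit [Finite W] in
theorem separates_trans {t : V ≃ₗ[ℝ] V} (ht : t ∈ reflections W) {x y z : V}
    (hx : x ∈ regularPoints W) (hy : y ∈ regularPoints W) (hz : z ∈ regularPoints W) :
    Separates t x z ↔ (Separates t x y ↔ ¬ Separates t y z) := by
  have h1 := refForm_ne_zero ht hx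
  have h2 := refForm_ne_zero ht hy
  have h3 := refForm_ne_zero ht hz
  simp only [Separates, mul_neg_iff, not_or, not_and, not_lt]
  rcases lt_or_gt_of_ne h1 with h1 | h1 <;> rcases lt_or_gt_of_ne h2 with h2 | h2 <;>
    rcases lt_or_gt_of_ne h3 with h3 | h3 <;>
    simp [h1, h2, h3, h3.le, h1.not_gt, h2.not_gt, h3.not_gt, h3.not_ge]

omit [FiniteDimensional ℝ V] [Finite W] in
theorem not_separates_self (t : V ≃ₗ[ℝ] V) (x : V) : ¬ Separates t x x :=
  not_lt.2 (mul_self_nonneg _)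

theorem separates_reflection {t : V ≃ₗ[ℝ] V} (ht : t ∈ reflections W) {x : V}
    (hx : x ∈ regularPoints W) : Separates t x (t x) := by
  rw [Separates, refForm_reflection ht, mul_neg]
  exact neg_lt_zero.2 (mul_self_pos.2 (refForm_ne_zero ht hx))

/-- Crossing a single wall `t` agrees, up to regions, with applying `t`. -/
theorem not_separates_of_adjacent {t : V ≃ₗ[ℝ] V} (ht : t ∈ reflections W) {x y : V}
    (hx : x ∈ regularPoints W) (hy : y ∈ regularPoints W)
    (h : ∀ s ∈ reflections W, Separates s x y ↔ s = t) {s : V ≃ₗ[ℝ] V} (hs : s ∈ reflections W) :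
    ¬ Separates s (t x) y := by
  have htx := apply_mem_regularPoints ht.1 hx
  have hxy : refForm t x * refForm t y < 0 := (h t ht).2 rfl
  by_cases hst : s = t
  · subst hst
    rw [separates_trans hs htx hx hy, separates_comm]
    simp [separates_reflection hs hx, show Separates s x y from hxy]
  set a := refForm t x
  set b := refForm t y
  -- Up to a positive factor, this is the point where the segment from x to y crosses the hyperplane
  -- of t.
  have hz : t (|b| • x + |a| • y) = |b| • x + |a| • y := by
    rw [← refForm_eq_zero_iff ht, map_add, map_smul, map_smul, smul_eq_mul, smul_eq_mul]
    change |b| * a + |a| * b = 0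
    rcases mul_neg_iff.1 hxy with ⟨h1, h2⟩ | ⟨h1, h2⟩
    · rw [abs_of_pos h1, abs_of_neg h2]; ring
    · rw [abs_of_neg h1, abs_of_pos h2]; ring
  have ha : 0 < |a| := abs_pos.2 (refForm_ne_zero ht hx)
  have hb : 0 < |b| := abs_pos.2 (refForm_ne_zero ht hy)
  set z := |b| • x + |a| • y with hzdef
  -- a point of the segment is on the same side as its ends for every other reflection
  have key : ∀ r ∈ reflections W, r ≠ t → 0 < refForm r x * refForm r z ∧
      0 < refForm r y * refForm r z := by
    intro r hr hrt
    have h1 : ¬ Separates r x y := fun h2 => hrt ((h r hr).1 h2)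
    have h2 := refForm_ne_zero hr hx
    have h3 := refForm_ne_zero hr hy
    have h4 : 0 < refForm r x * refForm r y :=
      lt_of_le_of_ne (not_lt.1 h1) (mul_ne_zero h2 h3).symm
    have h5 : refForm r z = |b| * refForm r x + |a| * refForm r y := by
      rw [hzdef, map_add, map_smul, map_smul, smul_eq_mul, smul_eq_mul]
    rw [h5]
    have h6 := mul_self_pos.2 h2
    have h7 := mul_self_pos.2 h3
    constructor
    · have := mul_pos hb h6
      have := mul_pos ha h4
      nlinarith
    · have := mul_pos ha h7
      have := mul_pos hb h4
      nlinarith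
  -- The hyperplane of tst⁻¹ does not separate x from z. Applying t, which fixes z, the hyperplane
  -- of s does not separate t x from z; nor does it separate z from y.
  have hr := conj_mem_reflections ht.1 hs
  have hrt : t * s * t⁻¹ ≠ t := by
    intro hc
    apply hst
    rw [mul_inv_eq_iff_eq_mul] at hc
    exact mul_left_cancel hc
  obtain ⟨c, hc, hform⟩ : ∃ c : ℝ, c ≠ 0 ∧ ∀ x,
      (refForm (t * s * t⁻¹) ∘ₗ (t : V →ₗ[ℝ] V)) x = c * refForm s x := by
    apply LinearMap.exists_eq_smul_of_ker_eq
    rw [LinearMap.ker_comp, ker_refForm hr, fixedSpace_conj,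
      ker_refForm hs, Submodule.comap_map_eq_of_injective t.injective]
  simp only [LinearMap.comp_apply, LinearEquiv.coe_coe] at hform
  have h1 := (key _ hr hrt).1
  have h2 := (key s hs hst).2
  have h3 := hform (t x)
  have h4 := hform z
  rw [reflection_apply_apply ht] at h3
  rw [hz] at h4
  rw [h3, h4] at h1
  have h5 : 0 < refForm s (t x) * refForm s z := by
    have h6 : c * refForm s (t x) * (c * refForm s z) =
      c ^ 2 * (refForm s (t x) * refForm s z) := by ring
    rw [h6] at h1
    exact (mul_pos_iff_of_pos_left (by positivity)).1 h1
  intro h6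
  have h7 := mul_pos h5 h2
  have h8 : refForm s (t x) * refForm s y * refForm s z ^ 2 ≤ 0 :=
    mul_nonpos_of_nonpos_of_nonneg (le_of_lt h6) (sq_nonneg _)
  nlinarith

end Finite

end RealReflectionGroup

/-! ### Galleries and the exchange argument -/

namespace RealReflectionGroup

variable {V : Type*} [AddCommGroup V] [Module ℝ V]

/-- `Gallery W k x z g`: there is a gallery of length `k` from the region of `x` to the region of
`z`, each step of which crosses exactly one reflecting hyperplane of `W`, and `g` is the product of
the reflections in the hyperplanes crossed. -/
inductive Gallery (W : Subgroup (V ≃ₗ[ℝ] V)) : ℕ → V → V → (V ≃ₗ[ℝ] V) → Prop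
  | nil (x z : V) (hx : x ∈ regularPoints W) (hz : z ∈ regularPoints W)
      (h : ∀ s ∈ reflections W, ¬ Separates s x z) : Gallery W 0 x z 1
  | cons (k : ℕ) (x y z : V) (t g : V ≃ₗ[ℝ] V) (ht : t ∈ reflections W)
      (hx : x ∈ regularPoints W) (h : ∀ s ∈ reflections W, Separates s x y ↔ s = t)
      (hg : Gallery W k y z g) : Gallery W (k + 1) x z (g * t)

variable {W : Subgroup (V ≃ₗ[ℝ] V)}

theorem Gallery.left_mem {k : ℕ} {x z : V} {g : V ≃ₗ[ℝ] V} (h : Gallery W k x z g) :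
    x ∈ regularPoints W := by
  cases h <;> assumption

theorem Gallery.right_mem {k : ℕ} {x z : V} {g : V ≃ₗ[ℝ] V} (h : Gallery W k x z g) :
    z ∈ regularPoints W := by
  induction h <;> assumption

variable [FiniteDimensional ℝ V]

theorem Gallery.congr_left {k : ℕ} {x x' z : V} {g : V ≃ₗ[ℝ] V} (h : Gallery W k x z g)
    (hx' : x' ∈ regularPoints W) (hxx' : ∀ s ∈ reflections W, ¬ Separates s x x') :
    Gallery W k x' z g := by
  cases h with
  | nil _ _ hx hz h =>
    refine .nil _ _ hx' hz fun s hs => ?_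
    rw [separates_trans hs hx' hx hz, separates_comm]
    simp [h s hs, hxx' s hs]
  | cons k _ y _ t g ht hx h hg =>
    refine .cons k _ y _ t g ht hx' (fun s hs => ?_) hg
    rw [← h s hs, separates_trans hs hx' hx hg.left_mem, separates_comm]
    simp [hxx' s hs]

theorem Gallery.append {j k : ℕ} {x y z : V} {g h : V ≃ₗ[ℝ] V} (hg : Gallery W j x y g)
    (hh : Gallery W k y z h) : Gallery W (j + k) x z (h * g) := by
  induction hg with
  | nil x y hx hy h =>
    rw [zero_add, mul_one]
    exact hh.congr_left hx fun s hs hc => h s hs hc.symm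
  | cons j x y z t g ht hx h hg ih =>
    rw [add_right_comm, ← mul_assoc]
    exact .cons _ _ _ _ _ _ ht hx h (ih hh)

variable [Finite W]

/-- The gallery must cross the hyperplane of t. Reflect by t the part before the first crossing and
drop that crossing: conjugating the earlier factors by t turns the product g into g * t. -/
theorem Gallery.exchange {k : ℕ} {y z : V} {g t : V ≃ₗ[ℝ] V} (h : Gallery W k y z g)
    (ht : t ∈ reflections W) (hs : Separates t y z) :
    ∃ j < k, Gallery W j (t y) z (g * t) := by
  induction h with
  | nil y z _ _ h => exact absurd hs (h t ht)
  | cons k x y z s g hs' hx h hg ih =>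
    by_cases hst : s = t
    · subst hst
      refine ⟨k, k.lt_succ_self, ?_⟩
      rw [mul_assoc, reflection_mul_self ht, mul_one]
      refine hg.congr_left (apply_mem_regularPoints ht.1 hx) fun r hr hc => ?_
      exact not_separates_of_adjacent ht hx hg.left_mem h hr hc.symm
    · have h1 : ¬ Separates t x y := fun hc => hst ((h t ht).1 hc).symm
      have h2 : Separates t y z := by
        rw [separates_trans ht hx hg.left_mem hg.right_mem] at hs
        by_contra h3
        exact h1 (hs.2 h3)
      obtain ⟨j, hj, h3⟩ := ih h2
      refine ⟨j + 1, by omega, ?_⟩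
      have h4 : g * s * t = g * t * (t * s * t⁻¹) := by
        rw [reflection_inv ht, ← mul_assoc, ← mul_assoc, mul_assoc g t t, reflection_mul_self ht,
          mul_one]
      rw [h4]
      refine .cons _ _ _ _ _ _ (conj_mem_reflections ht.1 hs')
        (apply_mem_regularPoints ht.1 hx) (fun r hr => ?_) h3
      have h5 := conj_mem_reflections (W.inv_mem ht.1) hr
      have h6 := separates_conj ht.1 h5 (x := x) (y := y)
      have h7 : t * (t⁻¹ * r * t⁻¹⁻¹) * t⁻¹ = r := by group
      rw [h7] at h6
      rw [h6, h _ h5]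
      constructor
      · rintro rfl
        exact h7.symm
      · rintro rfl
        group

/-- A closed gallery recrosses its first wall t. Exchange applied to the tail gives a shorter closed
gallery with the same product, since t y lies in the region of x. -/
theorem Gallery.eq_one {k : ℕ} {x z : V} {g : V ≃ₗ[ℝ] V} (h : Gallery W k x z g)
    (hs : ∀ s ∈ reflections W, ¬ Separates s x z) : g = 1 := by
  induction k using Nat.strong_induction_on generalizing x g with
  | _ k ih =>
  cases h with
  | nil => rfl
  | cons k _ y _ t g ht hx h hg =>
    have h1 : Separates t y z := by
      have h2 := hs t ht
      rw [separates_trans ht hx hg.left_mem hg.right_mem, (h t ht)] at h2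
      simpa using h2
    obtain ⟨j, hj, h2⟩ := hg.exchange ht h1
    have h3 := apply_mem_regularPoints ht.1 hx
    have h4 := h2.congr_left (x' := x) hx fun s hs' hc => ?_
    · exact ih j (by omega) h4 hs
    · refine not_separates_of_adjacent ht hg.left_mem hx (fun r hr => ?_) hs' hc
      rw [separates_comm]
      exact h r hr

/-- Prepend the reversed first step of one gallery to the other and induct on what remains of the
first. -/
theorem Gallery.unique {j k : ℕ} {x z : V} {g h : V ≃ₗ[ℝ] V} (hg : Gallery W j x z g)
    (hh : Gallery W k x z h) : g = h := by
  induction hg generalizing k h with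
  | nil x z _ _ hs => exact (hh.eq_one hs).symm
  | cons j x y z t g ht hx hs hg ih =>
    rw [ih (.cons _ _ _ _ _ _ ht hg.left_mem (fun s hs' => by rw [separates_comm]; exact hs s hs')
      hh), mul_assoc, reflection_mul_self ht, mul_one]

end RealReflectionGroup

/-! ### Generic points, existence of galleries, and Steinberg's theorem -/

namespace RealReflectionGroup

variable {V : Type*} [NormedAddCommGroup V] [NormedSpace ℝ V] [FiniteDimensional ℝ V]
  {W : Subgroup (V ≃ₗ[ℝ] V)} [Finite W]

theorem dense_iInter_compl_ker {ι : Type*} {s : Set ι} (hs : s.Finite) (f : ι → V →ₗ[ℝ] ℝ)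
    (hf : ∀ i ∈ s, f i ≠ 0) : Dense {x | ∀ i ∈ s, f i x ≠ 0} := by
  have h1 : {x | ∀ i ∈ s, f i x ≠ 0} = ⋂ i ∈ s, {x | f i x ≠ 0} := by
    ext; simp
  have h2 : ∀ i, IsOpen {x | f i x ≠ 0} := fun i =>
    isOpen_ne_fun (f i).continuous_of_finiteDimensional continuous_const
  rw [h1]
  refine dense_biInter_of_isOpen (fun i _ => h2 i) hs.countable fun i hi => ?_
  have h3 : {x | f i x ≠ 0} = (LinearMap.ker (f i) : Set V)ᶜ := by
    ext; simp
  rw [h3, ← interior_eq_empty_iff_dense_compl]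
  by_contra h4
  have h5 := Submodule.eq_top_of_nonempty_interior' _ (Set.nonempty_iff_ne_empty.2 h4)
  exact hf i hi (LinearMap.ker_eq_top.1 h5)

omit [FiniteDimensional ℝ V] in
theorem finite_reflections : (reflections W).Finite :=
  (Set.toFinite (W : Set (V ≃ₗ[ℝ] V))).subset fun _ h => h.1

omit [Finite W] in
theorem refForm_ne_zero_form {t : V ≃ₗ[ℝ] V} (ht : t ∈ reflections W) : refForm t ≠ 0 := by
  intro h
  have h1 : Module.finrank ℝ (fixedSpace t) + 1 = Module.finrank ℝ V := ht.2
  rw [← ker_refForm ht, h, LinearMap.ker_zero, finrank_top] at h1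
  omega

theorem dense_regularPoints : Dense (regularPoints W) := by
  convert dense_iInter_compl_ker (V := V) (finite_reflections (W := W)) refForm
    fun t ht => refForm_ne_zero_form ht using 1
  ext x
  exact forall₂_congr fun t ht => not_congr (refForm_eq_zero_iff ht).symm

/-- This is a neighbourhood of x in which two points can be separated only by hyperplanes through x.
-/
theorem isOpen_same_side (x : V) :
    IsOpen {y | ∀ t ∈ reflections W, refForm t x ≠ 0 → 0 < refForm t x * refForm t y} := by
  have h1 : {y | ∀ t ∈ reflections W, refForm t x ≠ 0 → 0 < refForm t x * refForm t y} =
      ⋂ t ∈ reflections W, {y | refForm t x ≠ 0 → 0 < refForm t x * refForm t y} := by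
    ext; simp
  rw [h1]
  refine finite_reflections.isOpen_biInter fun t _ => ?_
  by_cases h : refForm t x = 0
  · simp [h]
  · simp only [ne_eq, h, not_false_eq_true, true_imp_iff]
    exact isOpen_lt continuous_const
      (continuous_const.mul (refForm t).continuous_of_finiteDimensional)

/-- If `x` and `y` are separated, one can leave the region of `x` towards `y` crossing exactly one
hyperplane. -/
theorem exists_adjacent {x y : V} (hx : x ∈ regularPoints W) (hy : y ∈ regularPoints W)
    (h : ∃ t ∈ reflections W, Separates t x y) :
    ∃ t ∈ reflections W, ∃ z ∈ regularPoints W, Separates t x y ∧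
      (∀ s ∈ reflections W, Separates s x z ↔ s = t) ∧
      ∀ s ∈ reflections W, Separates s z y ↔ Separates s x y ∧ s ≠ t := by
  classical
  set P : Set ((V ≃ₗ[ℝ] V) × (V ≃ₗ[ℝ] V)) :=
    {p | p.1 ∈ reflections W ∧ p.2 ∈ reflections W ∧ p.1 ≠ p.2}
  have hP : P.Finite := (finite_reflections.prod finite_reflections).subset
    fun p hp => ⟨hp.1, hp.2.1⟩
  -- Perturb x inside its region so that the path x' + r y, r > 0, never meets two hyperplanes at
  -- the same r. The forms to avoid are nonzero because distinct reflections have distinct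
  -- hyperplanes.
  obtain ⟨x', hx', hx'P⟩ : ∃ x', (∀ t ∈ reflections W, 0 < refForm t x * refForm t x') ∧
      ∀ p ∈ P, refForm p.1 y * refForm p.2 x' ≠ refForm p.2 y * refForm p.1 x' := by
    have h1 := dense_iInter_compl_ker (V := V) hP
      (fun p => refForm p.1 y • refForm p.2 - refForm p.2 y • refForm p.1) fun p hp h0 => by
        have h2 : fixedSpace p.1 = fixedSpace p.2 := by
          rw [← ker_refForm hp.1, ← ker_refForm hp.2.1]
          rw [← LinearMap.ker_smul (refForm p.2) _ (refForm_ne_zero hp.1 hy),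
            ← LinearMap.ker_smul (refForm p.1) _ (refForm_ne_zero hp.2.1 hy), sub_eq_zero.1 h0]
        exact hp.2.2 (reflection_eq_of_fixedSpace_eq hp.1 hp.2.1 h2)
    obtain ⟨x', hx', h2⟩ := h1.exists_mem_open (isOpen_same_side (W := W) x)
      ⟨x, fun t _ h => mul_self_pos.2 h⟩
    refine ⟨x', fun t ht => h2 t ht (refForm_ne_zero ht hx), fun p hp => ?_⟩
    have h3 := hx' p hp
    simpa [sub_eq_zero] using h3
  set S := (finite_reflections (W := W)).toFinset.filter fun t => t ∈ reflections W ∧ Separates t x y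
    with hS
  have hmem : ∀ t, t ∈ S ↔ t ∈ reflections W ∧ Separates t x y := by simp [hS]
  set p : (V ≃ₗ[ℝ] V) → ℝ := fun t => refForm t x * refForm t x' with hp
  set q : (V ≃ₗ[ℝ] V) → ℝ := fun t => refForm t x * refForm t y with hq
  have hne : S.Nonempty := by
    obtain ⟨t, ht, h⟩ := h
    exact ⟨t, (hmem t).2 ⟨ht, h⟩⟩
  -- The ratio p t / -q t is the value of r at which x' + r y meets the hyperplane of t; the minimum
  -- is the first crossing.
  obtain ⟨t, htS, hmin⟩ := S.exists_min_image (fun t => p t / -q t) hne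
  obtain ⟨ht, htxy⟩ := (hmem t).1 htS
  have hlt : ∀ s ∈ S.erase t, p t / -q t < p s / -q s := by
    intro s hs
    obtain ⟨hst, hs⟩ := Finset.mem_erase.1 hs
    obtain ⟨hs1, hsxy⟩ := (hmem s).1 hs
    refine lt_of_le_of_ne (hmin s hs) fun heq => ?_
    rw [div_eq_div_iff (neg_ne_zero.2 (ne_of_lt htxy)) (neg_ne_zero.2 (ne_of_lt hsxy))] at heq
    refine hx'P (s, t) ⟨hs1, ht, hst⟩ ?_
    have h1 := refForm_ne_zero ht hx
    have h2 := refForm_ne_zero hs1 hx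
    apply mul_left_cancel₀ (mul_ne_zero h1 h2)
    simp only [hp] at heq
    linear_combination -heq
  obtain ⟨r, hr1, hr2⟩ : ∃ r, p t / -q t < r ∧ ∀ s ∈ S.erase t, r < p s / -q s := by
    have h1 : ∀ᶠ r in nhdsWithin (p t / -q t) (Set.Ioi (p t / -q t)),
        ∀ s ∈ S.erase t, r < p s / -q s :=
      (Filter.eventually_all_finset _).2 fun s hs =>
        (eventually_lt_nhds (hlt s hs)).filter_mono nhdsWithin_le_nhds
    obtain ⟨r, hr, hr'⟩ := (h1.and self_mem_nhdsWithin).exists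
    exact ⟨r, hr', hr⟩
  have hr0 : 0 < r := lt_trans (div_pos (hx' t ht) (neg_pos.2 htxy)) hr1
  have hz : ∀ s, refForm s x * refForm s (x' + r • y) = p s + r * q s := by
    intro s
    rw [map_add, map_smul, smul_eq_mul]
    ring
  have hz1 : ∀ s ∈ reflections W, s ≠ t → 0 < refForm s x * refForm s (x' + r • y) := by
    intro s hs hst
    rw [hz]
    have h1 : 0 < p s := hx' s hs
    by_cases h2 : Separates s x y
    · have h3 := hr2 s (Finset.mem_erase.2 ⟨hst, (hmem s).2 ⟨hs, h2⟩⟩)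
      rw [lt_div_iff₀ (neg_pos.2 h2)] at h3
      linarith
    · have h3 : 0 ≤ q s := not_lt.1 h2
      positivity
  have hz2 : Separates t x (x' + r • y) := by
    rw [Separates, hz]
    rw [div_lt_iff₀ (neg_pos.2 htxy)] at hr1
    linarith
  have hzreg : x' + r • y ∈ regularPoints W := by
    intro s hs hc
    rw [← refForm_eq_zero_iff hs] at hc
    by_cases hst : s = t
    · subst hst
      rw [Separates, hc, mul_zero] at hz2
      exact lt_irrefl _ hz2
    · have := hz1 s hs hst
      rw [hc, mul_zero] at this
      exact lt_irrefl _ this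
  have hz3 : ∀ s ∈ reflections W, Separates s x (x' + r • y) ↔ s = t := by
    intro s hs
    refine ⟨fun h => ?_, by rintro rfl; exact hz2⟩
    by_contra hst
    exact lt_asymm h (hz1 s hs hst)
  refine ⟨t, ht, _, hzreg, htxy, hz3, fun s hs => ?_⟩
  rw [separates_trans hs hzreg hx hy, separates_comm, hz3 s hs]
  by_cases hst : s = t
  · subst hst
    simp [htxy]
  · simp [hst]

/-- Induction on the number of separating hyperplanes: each step removes one and creates none.
Controlling the subgroup that contains the product is what later gives Steinberg's theorem. -/
theorem exists_gallery {x y : V} (hx : x ∈ regularPoints W) (hy : y ∈ regularPoints W) :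
    ∃ k, ∃ g ∈ Subgroup.closure {t | t ∈ reflections W ∧ Separates t x y}, Gallery W k x y g := by
  classical
  induction hn : {t | t ∈ reflections W ∧ Separates t x y}.ncard using Nat.strong_induction_on
    generalizing x with
  | _ n ih =>
  by_cases h : ∃ t ∈ reflections W, Separates t x y
  · obtain ⟨t, ht, z, hz, htxy, h1, h2⟩ := exists_adjacent hx hy h
    have hss : {s | s ∈ reflections W ∧ Separates s z y} ⊂
        {s | s ∈ reflections W ∧ Separates s x y} := by
      refine ⟨fun s hs => ⟨hs.1, ((h2 s hs.1).1 hs.2).1⟩, fun hc => ?_⟩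
      exact ((h2 t ht).1 (hc ⟨ht, htxy⟩).2).2 rfl
    have hlt := Set.ncard_lt_ncard hss (finite_reflections.subset fun s hs => hs.1)
    obtain ⟨k, g, hg, hG⟩ := ih _ (hn ▸ hlt) hz rfl
    exact ⟨k + 1, g * t, Subgroup.mul_mem _ (Subgroup.closure_mono hss.1 hg)
      (Subgroup.subset_closure ⟨ht, htxy⟩), .cons _ _ _ _ _ _ ht hx h1 hG⟩
  · push Not at h
    exact ⟨0, 1, Subgroup.one_mem _, .nil _ _ hx hy h⟩

/-- For a reflection t, exchange yields a closed gallery with product g * t, so g = t. For a product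
uv, compare with the concatenation x → v x → u v x. -/
theorem Gallery.eq_of_closure {w : V ≃ₗ[ℝ] V} (hw : w ∈ Subgroup.closure (reflections W)) {x : V}
    {k : ℕ} {g : V ≃ₗ[ℝ] V} (h : Gallery W k x (w x) g) : g = w := by
  have hle : Subgroup.closure (reflections W) ≤ W := (Subgroup.closure_le _).2 fun t ht => ht.1
  induction hw using Subgroup.closure_induction'' generalizing x k g with
  | one => exact h.eq_one fun s _ => not_separates_self s x
  | mem t ht =>
    obtain ⟨j, -, h1⟩ := h.exchange ht (separates_reflection ht h.left_mem)
    have h2 := h1.eq_one fun s _ => not_separates_self s _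
    rw [eq_inv_of_mul_eq_one_left h2, reflection_inv ht]
  | inv_mem t ht =>
    rw [reflection_inv ht] at h ⊢
    obtain ⟨j, -, h1⟩ := h.exchange ht (separates_reflection ht h.left_mem)
    have h2 := h1.eq_one fun s _ => not_separates_self s _
    rw [eq_inv_of_mul_eq_one_left h2, reflection_inv ht]
  | mul u v hu hv ihu ihv =>
    have hx := h.left_mem
    have hvx := apply_mem_regularPoints (hle hv) hx
    obtain ⟨i, a, -, ha⟩ := exists_gallery hx hvx
    obtain ⟨j, b, -, hb⟩ := exists_gallery hvx (apply_mem_regularPoints (hle hu) hvx)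
    rw [h.unique (ha.append hb), ihu hb, ihv ha]

/-- An element of `W` fixing `q` is a product of reflections of `W` fixing `q`. -/
theorem mem_closure_of_apply_eq (hW : IsGeneratedByReflections W) {w : V ≃ₗ[ℝ] V} (hw : w ∈ W)
    {q : V} (hq : w q = q) : w ∈ Subgroup.closure {t | t ∈ reflections W ∧ t q = q} := by
  have hopen := isOpen_same_side (W := W) q
  have hcont : Continuous w := w.toLinearMap.continuous_of_finiteDimensional
  -- Take x regular and so close to q that only hyperplanes through q can separate x from w x.
  obtain ⟨x, hx, hxq, hwxq⟩ := (dense_regularPoints (W := W)).exists_mem_open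
    (hopen.inter (hopen.preimage hcont))
    ⟨q, fun t _ h => mul_self_pos.2 h, fun t _ h => by rw [hq]; exact mul_self_pos.2 h⟩
  obtain ⟨k, g, hg, hG⟩ := exists_gallery hx (apply_mem_regularPoints hw hx)
  rw [hG.eq_of_closure (hW.symm ▸ hw)] at hg
  suffices hsub : {t | t ∈ reflections W ∧ Separates t x (w x)} ⊆
      {t | t ∈ reflections W ∧ t q = q} from Subgroup.closure_mono hsub hg
  refine fun t ht => ⟨ht.1, ?_⟩
  by_contra h
  have h0 : refForm t q ≠ 0 := fun h1 => h ((refForm_eq_zero_iff ht.1).1 h1)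
  have h1 := mul_pos (hxq t ht.1 h0) (hwxq t ht.1 h0)
  have h2 : refForm t x * refForm t (w x) * refForm t q ^ 2 ≤ 0 :=
    mul_nonpos_of_nonpos_of_nonneg (le_of_lt ht.2) (sq_nonneg _)
  nlinarith

omit [FiniteDimensional ℝ V] in
theorem mem_reflectionArrangement {H : Submodule ℝ V} :
    H ∈ (reflectionArrangement W).hyperplanes ↔ ∃ t ∈ reflections W, fixedSpace t = H := by
  simp [reflectionArrangement, reflections, and_assoc]

/-- The fixed space of every element of `W` is an intersection of reflecting hyperplanes. -/
theorem fixedSpace_mem_intersections (hW : IsGeneratedByReflections W) {w : V ≃ₗ[ℝ] V}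
    (hw : w ∈ W) : fixedSpace w ∈ (reflectionArrangement W).intersections := by
  classical
  set Y := fixedSpace w
  refine ⟨(reflectionArrangement W).hyperplanes.filter (Y ≤ ·), Finset.filter_subset _ _, ?_⟩
  apply le_antisymm
  · exact Finset.le_inf fun H hH => (Finset.mem_filter.1 hH).2
  -- For q generic in Y, a reflection fixing q fixes all of Y. So w is a product of reflections
  -- whose hyperplanes contain Y, and it fixes their intersection.
  obtain ⟨q, hq⟩ : ∃ q : Y, ∀ t ∈ reflections W, ¬ Y ≤ fixedSpace t → refForm t q ≠ 0 := by
    have h1 := dense_iInter_compl_ker (V := Y)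
      ((finite_reflections (W := W)).subset (Set.sep_subset _ fun t => ¬ Y ≤ fixedSpace t))
      (fun t => (refForm t).domRestrict Y) fun t ht h0 => by
        refine ht.2 fun y hy => ?_
        rw [← ker_refForm ht.1, LinearMap.mem_ker]
        exact LinearMap.congr_fun h0 ⟨y, hy⟩
    obtain ⟨q, hq⟩ := h1.nonempty
    exact ⟨q, fun t ht hY => hq t ⟨ht, hY⟩⟩
  have h1 := mem_closure_of_apply_eq hW hw (q := (q : V)) q.2
  intro x hx
  have h2 : Subgroup.closure {t | t ∈ reflections W ∧ t (q : V) = q} ≤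
      MulAction.stabilizer (V ≃ₗ[ℝ] V) x := by
    rw [Subgroup.closure_le]
    rintro t ⟨ht, htq⟩
    have h3 : Y ≤ fixedSpace t := by
      by_contra h4
      exact hq t ht h4 ((refForm_eq_zero_iff ht).2 htq)
    have h4 := Finset.inf_le (f := id) (Finset.mem_filter.2
      ⟨mem_reflectionArrangement.2 ⟨t, ht, rfl⟩, h3⟩) hx
    exact h4
  exact h2 h1

end RealReflectionGroup

/-! ### Determinant of a linear map of finite order -/

section Det

variable {V : Type*} [AddCommGroup V] [Module ℝ V] [FiniteDimensional ℝ V]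

/-- The determinant of 1 - s f is 1 at s = 0 and never vanishes on [0, 1]: s f x = x with x ≠ 0
gives s^k = 1, so s = 1 and x is fixed by f. -/
theorem LinearMap.det_one_sub_pos_of_pow_eq_one {f : V →ₗ[ℝ] V} {k : ℕ} (hk : 0 < k)
    (hf : f ^ k = 1) (hfix : ∀ x, f x = x → x = 0) : 0 < LinearMap.det (1 - f) := by
  have hne : ∀ s ∈ Set.Icc (0 : ℝ) 1, LinearMap.det (1 - s • f) ≠ 0 := by
    intro s hs hdet
    obtain ⟨x, hx, hx0⟩ := (Submodule.ne_bot_iff _).1 (LinearMap.bot_lt_ker_of_det_eq_zero hdet).ne'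
    rw [LinearMap.mem_ker, LinearMap.sub_apply, LinearMap.smul_apply, Module.End.one_apply,
      sub_eq_zero] at hx
    have h1 : ∀ j : ℕ, x = s ^ j • (f ^ j) x := by
      intro j
      induction j with
      | zero => simp
      | succ j ih =>
        rw [pow_succ' f, Module.End.mul_apply, pow_succ, mul_smul, smul_comm, ← map_smul, ← ih]
        exact hx
    have h2 := h1 k
    rw [hf, Module.End.one_apply] at h2
    have h3 : (1 - s ^ k) • x = 0 := by rw [sub_smul, one_smul, ← h2, sub_self]
    have h4 : s ^ k = 1 := (sub_eq_zero.1 ((smul_eq_zero.1 h3).resolve_right hx0)).symm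
    rw [pow_eq_one_iff_of_nonneg hs.1 hk.ne'] at h4
    rw [h4, one_smul] at hx
    exact hx0 (hfix x hx.symm)
  have hcont : Continuous fun s : ℝ => LinearMap.det (1 - s • f) := by
    have h1 : ∀ s : ℝ, LinearMap.det (1 - s • f) =
        (1 - s • LinearMap.toMatrix (Module.finBasis ℝ V) (Module.finBasis ℝ V) f).det := by
      intro s
      rw [← LinearMap.det_toMatrix (Module.finBasis ℝ V), map_sub, map_smul,
        LinearMap.toMatrix_one]
    simp_rw [h1]
    exact Continuous.matrix_det (by fun_prop)
  by_contra hneg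
  obtain ⟨s, hs, h0⟩ := intermediate_value_Icc' (zero_le_one (α := ℝ)) hcont.continuousOn
    (show (0 : ℝ) ∈ Set.Icc _ _ by simpa using hneg)
  exact hne s hs h0

/-- With g the inverse of f, 1 - f = -f(1 - g). Both 1 - f and 1 - g have positive determinant,
which fixes the sign of det f; its absolute value is 1. -/
theorem LinearMap.det_of_pow_eq_one_of_fixed_eq_zero {f : V →ₗ[ℝ] V} {k : ℕ} (hk : 0 < k)
    (hf : f ^ k = 1) (hfix : ∀ x, f x = x → x = 0) :
    LinearMap.det f = (-1) ^ Module.finrank ℝ V := by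
  obtain ⟨j, rfl⟩ : ∃ j, k = j + 1 := ⟨k - 1, by omega⟩
  set g := f ^ j with hg
  have hfg : f * g = 1 := by rw [hg, ← pow_succ', hf]
  have hgk : g ^ (j + 1) = 1 := by rw [hg, ← pow_mul, mul_comm, pow_mul, hf, one_pow]
  have hgfix : ∀ x, g x = x → x = 0 := by
    intro x hx
    apply hfix
    nth_rewrite 1 [← hx]
    rw [← Module.End.mul_apply, hfg, Module.End.one_apply]
  have h1 := det_one_sub_pos_of_pow_eq_one hk hf hfix
  have h2 := det_one_sub_pos_of_pow_eq_one hk hgk hgfix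
  have h3 : 1 - f = (-1 : ℝ) • (f * (1 - g)) := by
    rw [mul_sub, hfg, mul_one, neg_one_smul, neg_sub]
  rw [h3, LinearMap.det_smul, map_mul, ← mul_assoc] at h1
  have h4 := pos_of_mul_pos_left h1 h2.le
  have h5 : |LinearMap.det f| = 1 := by
    refine (pow_eq_one_iff_of_nonneg (abs_nonneg _) hk.ne').1 ?_
    rw [← abs_pow, ← map_pow, hf, map_one, abs_one]
  rcases neg_one_pow_eq_or ℝ (Module.finrank ℝ V) with h | h <;> rw [h] at h4 ⊢ <;>
    rcases (abs_eq zero_le_one).1 h5 with h6 | h6 <;> rw [h6] at h4 ⊢ <;> norm_num at h4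

/-- Split off the fixed space E. The quotient map has no nonzero fixed vector: if u = f x - x lies
in E, then f^k x = x + k u forces u = 0. -/
theorem LinearMap.det_of_pow_eq_one {f : V →ₗ[ℝ] V} {k : ℕ} (hk : 0 < k) (hf : f ^ k = 1) :
    LinearMap.det f =
      (-1) ^ (Module.finrank ℝ V - Module.finrank ℝ (LinearMap.eqLocus f LinearMap.id)) := by
  set E := LinearMap.eqLocus f LinearMap.id with hE
  have hE' : ∀ x, x ∈ E ↔ f x = x := fun x => Iff.rfl
  have hcomap : E ≤ E.comap f := by
    intro x hx
    rw [Submodule.mem_comap, (hE' x).1 hx]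
    exact hx
  have hres : f.restrict (p := E) (q := E) hcomap = 1 := by
    ext x
    exact (hE' x).1 x.2
  have hfin : Module.finrank ℝ (V ⧸ E) = Module.finrank ℝ V - Module.finrank ℝ E := by
    rw [← E.finrank_quotient_add_finrank, Nat.add_sub_cancel]
  rw [f.det_eq_det_mul_det E hcomap, hres, map_one, one_mul, ← hfin]
  have hpow : ∀ (j : ℕ) x, ((E.mapQ E f hcomap) ^ j) (E.mkQ x) = E.mkQ ((f ^ j) x) := by
    intro j x
    induction j with
    | zero => simp
    | succ j ih => rw [pow_succ', Module.End.mul_apply, ih, pow_succ', Module.End.mul_apply]; rfl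
  refine det_of_pow_eq_one_of_fixed_eq_zero hk ?_ ?_
  · ext x
    simp only [LinearMap.comp_apply]
    rw [hpow, hf]
    rfl
  · intro x hx
    obtain ⟨x, rfl⟩ := E.mkQ_surjective x
    have h1 : E.mkQ (f x) = E.mkQ x := hx
    rw [← sub_eq_zero, ← map_sub, ← LinearMap.mem_ker, Submodule.ker_mkQ, hE', map_sub] at h1
    set u := f x - x with hu
    have hfu : f u = u := by rw [hu, map_sub]; exact h1
    have h2 : ∀ j : ℕ, (f ^ j) x = x + (j : ℝ) • u := by
      intro j
      induction j with
      | zero => simp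
      | succ j ih =>
        rw [pow_succ', Module.End.mul_apply, ih, map_add, map_smul, hfu,
          show f x = x + u by rw [hu]; abel, Nat.cast_succ]
        module
    have h3 := h2 k
    rw [hf, Module.End.one_apply, left_eq_add] at h3
    have h4 : u = 0 := (smul_eq_zero.1 h3).resolve_left (by exact_mod_cast hk.ne')
    rw [← LinearMap.mem_ker, Submodule.ker_mkQ, hE']
    exact sub_eq_zero.1 h4

end Det

/-! ### The Möbius function of a reflection arrangement -/

namespace HyperplaneArrangement

variable {V : Type*} [AddCommGroup V] [Module ℝ V] (A : HyperplaneArrangement V)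

open Classical in
theorem sum_moebius (Y : ↥A.intersections) :
    (∑ X ∈ Finset.univ.filter (fun X : ↥A.intersections => (Y : Submodule ℝ V) ≤ X), A.moebius X) =
      if (Y : Submodule ℝ V) = ⊤ then 1 else 0 := by
  have h1 := IncidenceAlgebra.sum_Icc_mu_right (𝕜 := ℤ) A.bottom (OrderDual.toDual Y)
  have h2 : A.bottom = OrderDual.toDual Y ↔ (Y : Submodule ℝ V) = ⊤ := by
    rw [bottom, OrderDual.toDual_inj, eq_comm, Subtype.ext_iff]
  simp only [h2] at h1
  rw [← h1]
  refine Finset.sum_equiv OrderDual.toDual (fun X => ?_) fun X _ => rfl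
  rw [Finset.mem_filter, Finset.mem_Icc]
  refine ⟨fun h => ⟨?_, h.2⟩, fun h => ⟨Finset.mem_univ _, h.2⟩⟩
  exact OrderDual.toDual_le_toDual.2 (show (X : Submodule ℝ V) ≤ ⊤ from le_top)

-- The defining sums determine μ by recursion from V down to smaller subspaces.
open Classical in
theorem moebius_eq_of_sum_eq [FiniteDimensional ℝ V] (g : ↥A.intersections → ℤ)
    (hg : ∀ Y : ↥A.intersections,
      (∑ X ∈ Finset.univ.filter (fun X : ↥A.intersections => (Y : Submodule ℝ V) ≤ X), g X) =
        if (Y : Submodule ℝ V) = ⊤ then 1 else 0) (X : ↥A.intersections) :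
    A.moebius X = g X := by
  obtain ⟨X, hX⟩ := X
  induction X using WellFoundedGT.induction with
  | _ X ih =>
  have h1 := (A.sum_moebius ⟨X, hX⟩).trans (hg ⟨X, hX⟩).symm
  have hmem : (⟨X, hX⟩ : ↥A.intersections) ∈
      ({Z : ↥A.intersections | X ≤ (Z : Submodule ℝ V)} : Finset _) := by simp
  rw [← Finset.add_sum_erase _ _ hmem, ← Finset.add_sum_erase _ _ hmem] at h1
  have h2 : ∀ Z ∈ ({Z : ↥A.intersections | X ≤ (Z : Submodule ℝ V)} : Finset _).erase ⟨X, hX⟩,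
      A.moebius Z = g Z := by
    intro Z hZ
    obtain ⟨hne, hZ⟩ := Finset.mem_erase.1 hZ
    exact ih Z (lt_of_le_of_ne (Finset.mem_filter.1 hZ).2 fun h => hne (Subtype.ext h.symm)) Z.2
  rw [Finset.sum_congr rfl h2] at h1
  exact add_right_cancel h1

end HyperplaneArrangement

namespace RealReflectionGroup

variable {V : Type*} [NormedAddCommGroup V] [NormedSpace ℝ V] [FiniteDimensional ℝ V]
  {W : Subgroup (V ≃ₗ[ℝ] V)} [Finite W]

theorem det_eq_neg_one_pow {w : V ≃ₗ[ℝ] V} (hw : w ∈ W) :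
    LinearMap.det (w : V →ₗ[ℝ] V) =
      (-1) ^ (Module.finrank ℝ V - Module.finrank ℝ (fixedSpace w)) := by
  obtain ⟨k, hk, h⟩ := (isOfFinOrder_of_mem hw).exists_pow_eq_one
  refine LinearMap.det_of_pow_eq_one hk ?_
  have h1 : ∀ j : ℕ, (w : V →ₗ[ℝ] V) ^ j = ((w ^ j : V ≃ₗ[ℝ] V) : V →ₗ[ℝ] V) := by
    intro j
    induction j with
    | zero => rfl
    | succ j ih => rw [pow_succ, ih, pow_succ]; rfl
  rw [h1, h]
  rfl

theorem neg_one_pow_codim_reflection_mul {t w : V ≃ₗ[ℝ] V} (ht : t ∈ reflections W) (hw : w ∈ W) :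
    (-1 : ℤ) ^ (Module.finrank ℝ V - Module.finrank ℝ (fixedSpace (t * w))) =
      - (-1) ^ (Module.finrank ℝ V - Module.finrank ℝ (fixedSpace w)) := by
  have h1 := det_eq_neg_one_pow (W.mul_mem ht.1 hw)
  have h2 : ((t * w : V ≃ₗ[ℝ] V) : V →ₗ[ℝ] V) = (t : V →ₗ[ℝ] V) * (w : V →ₗ[ℝ] V) := rfl
  have h3 : Module.finrank ℝ V - Module.finrank ℝ (fixedSpace t) = 1 := by
    have : Module.finrank ℝ (fixedSpace t) + 1 = Module.finrank ℝ V := ht.2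
    omega
  rw [h2, map_mul, det_eq_neg_one_pow hw, det_eq_neg_one_pow ht.1, h3] at h1
  have h4 : ((-1 : ℤ) : ℝ) = -1 := by norm_num
  rw [← Int.cast_inj (α := ℝ), Int.cast_neg, Int.cast_pow, Int.cast_pow, h4, ← h1]
  ring

open Classical in
/-- The Möbius function of a reflection arrangement counts group elements with given fixed space. -/
theorem moebius_eq_sum (hW : IsGeneratedByReflections W)
    (X : ↥(reflectionArrangement W).intersections) :
    (reflectionArrangement W).moebius X =
      (-1) ^ (Module.finrank ℝ V - Module.finrank ℝ (X : Submodule ℝ V)) *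
        ({w : W | fixedSpace (w : V ≃ₗ[ℝ] V) = X}.ncard : ℤ) := by
  have := Fintype.ofFinite W
  set ε : W → ℤ := fun w =>
    (-1) ^ (Module.finrank ℝ V - Module.finrank ℝ (fixedSpace (w : V ≃ₗ[ℝ] V)))
  set F : W → ↥(reflectionArrangement W).intersections :=
    fun w => ⟨fixedSpace (w : V ≃ₗ[ℝ] V), fixedSpace_mem_intersections hW w.2⟩
  rw [HyperplaneArrangement.moebius_eq_of_sum_eq _ (fun X => ∑ w with F w = X, ε w)]
  · rw [Set.ncard_eq_toFinset_card']
    have h1 : ∀ w ∈ ({w | F w = X} : Finset W), ε w =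
        (-1) ^ (Module.finrank ℝ V - Module.finrank ℝ (X : Submodule ℝ V)) := by
      intro w hw
      rw [← (Finset.mem_filter.1 hw).2]
    rw [Finset.sum_congr rfl h1, Finset.sum_const, nsmul_eq_mul, mul_comm]
    congr 3
    ext w
    simp [F, Subtype.ext_iff]
  intro Y
  have h1 : (∑ X ∈ Finset.univ.filter (fun X : ↥(reflectionArrangement W).intersections => (Y : Submodule ℝ V) ≤ X),
      ∑ w with F w = X, ε w) =
      ∑ w ∈ Finset.univ.filter (fun w : W => (Y : Submodule ℝ V) ≤ fixedSpace (w : V ≃ₗ[ℝ] V)), ε w := by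
    rw [← Finset.sum_fiberwise_of_maps_to (g := F) (t := Finset.univ.filter
      fun X : ↥(reflectionArrangement W).intersections => (Y : Submodule ℝ V) ≤ X)]
    · refine Finset.sum_congr rfl fun X hX => Finset.sum_congr ?_ fun _ _ => rfl
      ext w
      simp only [Finset.mem_filter, Finset.mem_univ, true_and] at hX ⊢
      refine ⟨fun h => ⟨?_, h⟩, fun h => h.2⟩
      rw [← h] at hX
      exact hX
    · intro w hw
      exact Finset.mem_filter.2 ⟨Finset.mem_univ _, (Finset.mem_filter.1 hw).2⟩
  rw [h1]
  split_ifs with hY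
  · rw [hY, Finset.sum_eq_single_of_mem 1]
    · have : fixedSpace ((1 : W) : V ≃ₗ[ℝ] V) = ⊤ := by
        rw [eq_top_iff]
        exact fun x _ => rfl
      simp only [ε]
      rw [this, finrank_top, Nat.sub_self, pow_zero]
    · simp only [Finset.mem_filter, Finset.mem_univ, true_and]
      exact fun x _ => rfl
    · intro w hw hw1
      refine absurd (Subtype.ext (LinearEquiv.ext fun x => ?_)) hw1
      exact (Finset.mem_filter.1 hw).2 (Submodule.mem_top (x := x))
  -- Left multiplication by such a t permutes the pointwise stabiliser of Y and flips every sign, so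
  -- the sum equals its own negative.
  · obtain ⟨t, ht, htY⟩ : ∃ t ∈ reflections W, (Y : Submodule ℝ V) ≤ fixedSpace t := by
      obtain ⟨B, hB, hYB⟩ := Y.2
      have hne : B.Nonempty := by
        by_contra h
        rw [Finset.not_nonempty_iff_eq_empty.1 h, Finset.inf_empty] at hYB
        exact hY hYB
      obtain ⟨H, hH⟩ := hne
      obtain ⟨t, ht, rfl⟩ := mem_reflectionArrangement.1 (hB hH)
      exact ⟨t, ht, hYB ▸ Finset.inf_le (f := id) hH⟩
    have h2 : ∑ w ∈ Finset.univ.filter (fun w : W => (Y : Submodule ℝ V) ≤ fixedSpace (w : V ≃ₗ[ℝ] V)), ε w =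
        ∑ w ∈ Finset.univ.filter (fun w : W => (Y : Submodule ℝ V) ≤ fixedSpace (w : V ≃ₗ[ℝ] V)), - ε w := by
      refine Finset.sum_equiv (Equiv.mulLeft (⟨t, ht.1⟩ : W)) (fun w => ?_) fun w _ => ?_
      · simp only [Finset.mem_filter, Finset.mem_univ, true_and]
        refine forall₂_congr fun y hy => ?_
        have h3 : t y = y := htY hy
        simp only [mem_fixedSpace, Equiv.coe_mulLeft, Subgroup.coe_mul, LinearEquiv.mul_apply]
        constructor
        · intro h
          rw [h, h3]
        · intro h
          exact t.injective (h.trans h3.symm)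
      · exact (neg_eq_iff_eq_neg.2 (neg_one_pow_codim_reflection_mul ht w.2)).symm
    rw [Finset.sum_neg_distrib] at h2
    omega

end RealReflectionGroup

/-! ### Euler characteristics of convex sets cut by hyperplanes -/

section Euler

theorem Submodule.finrank_inf_ker_add_one {V : Type*} [AddCommGroup V] [Module ℝ V]
    [FiniteDimensional ℝ V] (X : Submodule ℝ V) (f : V →ₗ[ℝ] ℝ) (h : ¬ X ≤ LinearMap.ker f) :
    Module.finrank ℝ ↥(X ⊓ LinearMap.ker f) + 1 = Module.finrank ℝ X := by
  have h0 : f.domRestrict X ≠ 0 := fun h0 => h fun x hx => LinearMap.congr_fun h0 ⟨x, hx⟩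
  have h1 := (f.domRestrict X).finrank_range_add_finrank_ker
  rw [LinearMap.range_eq_top.2 (LinearMap.surjective h0), finrank_top, Module.finrank_self] at h1
  have h2 : LinearMap.ker (f.domRestrict X) = (LinearMap.ker f).comap X.subtype := rfl
  rw [← h1, add_comm, h2, ← Submodule.map_comap_subtype, Submodule.finrank_map_subtype_eq]

variable {V : Type*} [NormedAddCommGroup V] [NormedSpace ℝ V] [FiniteDimensional ℝ V]

omit [FiniteDimensional ℝ V] in
theorem exists_pos_of_isOpen {U : Set V} (hU : IsOpen U) {X : Submodule ℝ V} {f : V →ₗ[ℝ] ℝ}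
    {x e : V} (hx : x ∈ X) (hxU : x ∈ U) (hfx : f x = 0) (he : e ∈ X) (hfe : 0 < f e) :
    ∃ y ∈ X, y ∈ U ∧ 0 < f y := by
  have h1 : Continuous fun r : ℝ => x + r • e := by fun_prop
  have h2 : ∀ᶠ r : ℝ in nhdsWithin 0 (Set.Ioi 0), x + r • e ∈ U :=
    nhdsWithin_le_nhds (h1.continuousAt.preimage_mem_nhds (hU.mem_nhds (by simpa using hxU)))
  obtain ⟨r, hr, hr0⟩ := (h2.and self_mem_nhdsWithin).exists
  refine ⟨_, X.add_mem hx (X.smul_mem r he), hr, ?_⟩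
  rw [map_add, hfx, zero_add, map_smul, smul_eq_mul]
  exact mul_pos hr0 hfe

omit [FiniteDimensional ℝ V] in
theorem Convex.exists_apply_eq_zero {U : Set V} (hU : Convex ℝ U) {X : Submodule ℝ V}
    {f : V →ₗ[ℝ] ℝ} {x y : V} (hx : x ∈ X) (hxU : x ∈ U) (hy : y ∈ X) (hyU : y ∈ U)
    (hfx : 0 < f x) (hfy : f y < 0) : ∃ z ∈ X, z ∈ U ∧ f z = 0 := by
  have h1 : 0 < f x - f y := by linarith
  have h2 := (hU.inter X.convex) ⟨hxU, hx⟩ ⟨hyU, hy⟩ (a := -f y / (f x - f y))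
    (b := f x / (f x - f y)) (div_nonneg (by linarith) h1.le) (div_nonneg hfx.le h1.le)
    (by field_simp; ring)
  refine ⟨_, h2.2, h2.1, ?_⟩
  rw [map_add, map_smul, map_smul, smul_eq_mul, smul_eq_mul]
  ring

open Classical in
/-- The Euler characteristic with compact support of `X ∩ U`, for `U` open and convex. -/
noncomputable def convexEuler (U : Set V) (X : Submodule ℝ V) : ℤ :=
  if ∃ x ∈ X, x ∈ U then (-1) ^ Module.finrank ℝ X else 0

omit [FiniteDimensional ℝ V] in
theorem convexEuler_of_exists {U : Set V} {X : Submodule ℝ V} (h : ∃ x ∈ X, x ∈ U) :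
    convexEuler U X = (-1) ^ Module.finrank ℝ X := if_pos h

omit [FiniteDimensional ℝ V] in
theorem convexEuler_of_not_exists {U : Set V} {X : Submodule ℝ V} (h : ¬ ∃ x ∈ X, x ∈ U) :
    convexEuler U X = 0 := if_neg h

/-- If ker f cuts X ∩ U properly, openness gives points on both sides and (-1)^(d-1) + 2(-1)^d =
(-1)^d. If X ∩ U is nonempty and misses ker f, convexity keeps it on one side. -/
theorem convexEuler_split {U : Set V} (hU : IsOpen U) (hc : Convex ℝ U) (X : Submodule ℝ V)
    (f : V →ₗ[ℝ] ℝ) :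
    convexEuler U (X ⊓ LinearMap.ker f) + convexEuler (U ∩ {x | f x < 0}) X +
      convexEuler (U ∩ {x | 0 < f x}) X = convexEuler U X := by
  by_cases hne : ∃ x ∈ X, x ∈ U
  swap
  · rw [convexEuler_of_not_exists hne, convexEuler_of_not_exists, convexEuler_of_not_exists,
      convexEuler_of_not_exists]
    · rfl
    · exact fun ⟨x, hx, h⟩ => hne ⟨x, hx, h.1⟩
    · exact fun ⟨x, hx, h⟩ => hne ⟨x, hx, h.1⟩
    · exact fun ⟨x, hx, h⟩ => hne ⟨x, hx.1, h⟩
  by_cases hX : X ≤ LinearMap.ker f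
  · rw [inf_eq_left.2 hX, convexEuler_of_not_exists (U := U ∩ {x | f x < 0}),
      convexEuler_of_not_exists (U := U ∩ {x | 0 < f x}), add_zero, add_zero]
    · exact fun ⟨x, hx, h⟩ => h.2.ne' (hX hx)
    · exact fun ⟨x, hx, h⟩ => h.2.ne (hX hx)
  have hdim := X.finrank_inf_ker_add_one f hX
  rw [convexEuler_of_exists hne]
  by_cases hz : ∃ x ∈ X, x ∈ U ∧ f x = 0
  · obtain ⟨x, hx, hxU, hfx⟩ := hz
    obtain ⟨e, he, hfe⟩ : ∃ e ∈ X, 0 < f e := by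
      obtain ⟨e, he, hfe⟩ := SetLike.not_le_iff_exists.1 hX
      rcases lt_or_gt_of_ne hfe with h | h
      · exact ⟨-e, X.neg_mem he, by rw [map_neg]; exact neg_pos.2 h⟩
      · exact ⟨e, he, h⟩
    obtain ⟨y, hy, hyU, hfy⟩ := exists_pos_of_isOpen hU hx hxU hfx he hfe
    obtain ⟨z, hz, hzU, hfz⟩ := exists_pos_of_isOpen (f := -f) hU hx hxU (by simp [hfx])
      (X.neg_mem he) (by simpa using hfe)
    rw [convexEuler_of_exists ⟨x, Submodule.mem_inf.2 ⟨hx, hfx⟩, hxU⟩,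
      convexEuler_of_exists (U := U ∩ {x | f x < 0}) ⟨z, hz, hzU, by simpa using hfz⟩,
      convexEuler_of_exists (U := U ∩ {x | 0 < f x}) ⟨y, hy, hyU, hfy⟩, ← hdim, pow_succ]
    ring
  · have hz' : ¬ ∃ x ∈ X ⊓ LinearMap.ker f, x ∈ U :=
      fun ⟨x, hx, hxU⟩ => hz ⟨x, hx.1, hxU, hx.2⟩
    rw [convexEuler_of_not_exists hz', zero_add]
    obtain ⟨x, hx, hxU⟩ := hne
    rcases lt_trichotomy (f x) 0 with h | h | h
    · rw [convexEuler_of_exists (U := U ∩ {x | f x < 0}) ⟨x, hx, hxU, h⟩, convexEuler_of_not_exists, add_zero]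
      exact fun ⟨y, hy, hyU⟩ => hz (hc.exists_apply_eq_zero hy hyU.1 hx hxU hyU.2 h)
    · exact absurd ⟨x, hx, hxU, h⟩ hz
    · rw [convexEuler_of_exists (U := U ∩ {x | 0 < f x}) ⟨x, hx, hxU, h⟩,
        convexEuler_of_not_exists, zero_add]
      exact fun ⟨y, hy, hyU⟩ => hz (hc.exists_apply_eq_zero hx hxU hy hyU.1 h hyU.2)

open Classical in
/-- The contribution to the Euler characteristic of `X ∩ U` of the face with sign vector `σ`. -/
noncomputable def faceEuler {ι : Type*} (f : ι → V →ₗ[ℝ] ℝ) (U : Set V) (X : Submodule ℝ V)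
    (σ : ι → SignType) : ℤ :=
  if ∃ x ∈ X, x ∈ U ∧ ∀ i, SignType.sign (f i x) = σ i then
    (-1) ^ Module.finrank ℝ ↥(X ⊓ ⨅ i, ⨅ _ : σ i = 0, LinearMap.ker (f i)) else 0

omit [FiniteDimensional ℝ V] in
theorem faceEuler_congr {ι κ : Type*} {f : ι → V →ₗ[ℝ] ℝ} {g : κ → V →ₗ[ℝ] ℝ} {U U' : Set V}
    {X X' : Submodule ℝ V} {σ : ι → SignType} {τ : κ → SignType}
    (h1 : ∀ x, (x ∈ X ∧ x ∈ U ∧ ∀ i, SignType.sign (f i x) = σ i) ↔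
      (x ∈ X' ∧ x ∈ U' ∧ ∀ i, SignType.sign (g i x) = τ i))
    (h2 : ∀ x, (x ∈ X ∧ ∀ i, σ i = 0 → f i x = 0) ↔ (x ∈ X' ∧ ∀ i, τ i = 0 → g i x = 0)) :
    faceEuler f U X σ = faceEuler g U' X' τ := by
  have h3 : X ⊓ ⨅ i, ⨅ _ : σ i = 0, LinearMap.ker (f i) =
      X' ⊓ ⨅ i, ⨅ _ : τ i = 0, LinearMap.ker (g i) := by
    ext x
    simpa [Submodule.mem_iInf] using h2 x
  classical
  rw [faceEuler, faceEuler, h3]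
  exact if_congr (exists_congr h1) rfl rfl

/-- Cut by one form at a time. Sign 0 shrinks X and signs ±1 shrink U, so the induction must let
both vary. -/
theorem sum_faceEuler_fin {m : ℕ} (f : Fin m → V →ₗ[ℝ] ℝ) {U : Set V} (hU : IsOpen U)
    (hc : Convex ℝ U) (X : Submodule ℝ V) :
    ∑ σ : Fin m → SignType, faceEuler f U X σ = convexEuler U X := by
  classical
  induction m generalizing U X with
  | zero =>
    have σ : Fin 0 → SignType := Fin.elim0
    rw [Fintype.sum_subsingleton _ σ]
    have hX : X ⊓ ⨅ i, ⨅ _ : σ i = 0, LinearMap.ker (f i) = X := by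
      simp
    rw [faceEuler, convexEuler, hX]
    exact if_congr (by simp) rfl rfl
  | succ m ih =>
    have hf : Continuous (f 0) := (f 0).continuous_of_finiteDimensional
    have huniv : (Finset.univ : Finset SignType) = {0, -1, 1} := rfl
    rw [← (Fin.consEquiv fun _ : Fin (m + 1) => SignType).sum_comp, Fintype.sum_prod_type, huniv,
      Finset.sum_insert (by decide), Finset.sum_pair (by decide), ← convexEuler_split hU hc X (f 0),
      ← add_assoc]
    rw [← ih (fun i => f i.succ) hU hc, ← ih (fun i => f i.succ)
      (hU.inter (isOpen_lt hf continuous_const)) (hc.inter (convex_halfSpace_lt (f 0).isLinear 0)),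
      ← ih (fun i => f i.succ)
      (hU.inter (isOpen_lt continuous_const hf)) (hc.inter (convex_halfSpace_gt (f 0).isLinear 0))]
    congr 1
    · congr 1
      · refine Finset.sum_congr rfl fun τ _ => faceEuler_congr (fun x => ?_) fun x => ?_
        · simp [Fin.forall_fin_succ, Fin.consEquiv]
          tauto
        · simp [Fin.forall_fin_succ, Fin.consEquiv]
          tauto
      · refine Finset.sum_congr rfl fun τ _ => faceEuler_congr (fun x => ?_) fun x => ?_
        · simp [Fin.forall_fin_succ, Fin.consEquiv, sign_eq_neg_one_iff]
          tauto
        · simp [Fin.forall_fin_succ, Fin.consEquiv]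
    · refine Finset.sum_congr rfl fun τ _ => faceEuler_congr (fun x => ?_) fun x => ?_
      · simp [Fin.forall_fin_succ, Fin.consEquiv, sign_eq_one_iff]
        tauto
      · simp [Fin.forall_fin_succ, Fin.consEquiv]

theorem sum_faceEuler {ι : Type*} [Fintype ι] [DecidableEq ι] (f : ι → V →ₗ[ℝ] ℝ) {U : Set V}
    (hU : IsOpen U) (hc : Convex ℝ U) (X : Submodule ℝ V) :
    ∑ σ : ι → SignType, faceEuler f U X σ = convexEuler U X := by
  set e := Fintype.equivFin ι
  rw [← sum_faceEuler_fin (fun i => f (e.symm i)) hU hc X,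
    ← (e.arrowCongr (Equiv.refl SignType)).sum_comp]
  refine Finset.sum_congr rfl fun σ _ => faceEuler_congr (fun x => ?_) fun x => ?_
  · simp [e.symm.forall_congr_left]
  · simp [e.symm.forall_congr_left]

end Euler

/-! ### Faces, Zaslavsky's formula and chambers of a cone -/

namespace HyperplaneArrangement

variable {V : Type*} [NormedAddCommGroup V] [NormedSpace ℝ V] [FiniteDimensional ℝ V]
  (A : HyperplaneArrangement V)

theorem ker_form {H : Submodule ℝ V} (hH : H ∈ A.hyperplanes) : LinearMap.ker H.form = H :=
  H.ker_form (A.finrank_add_one H hH)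

theorem form_eq_zero_iff {H : Submodule ℝ V} (hH : H ∈ A.hyperplanes) {x : V} :
    H.form x = 0 ↔ x ∈ H := by
  rw [← LinearMap.mem_ker, A.ker_form hH]

/-- The sign vector of a point. -/
noncomputable def signVector (x : V) (H : A.hyperplanes) : SignType :=
  SignType.sign ((H : Submodule ℝ V).form x)

/-- The sign vectors of the points of `K`. -/
def faces (K : Set V) : Set (A.hyperplanes → SignType) := A.signVector '' K

/-- The intersection of the hyperplanes on which a sign vector vanishes. -/
def flat (σ : A.hyperplanes → SignType) : Submodule ℝ V := ⨅ H, ⨅ _ : σ H = 0, (H : Submodule ℝ V)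

omit [FiniteDimensional ℝ V] in
theorem mem_flat {σ : A.hyperplanes → SignType} {x : V} :
    x ∈ A.flat σ ↔ ∀ H, σ H = 0 → x ∈ (H : Submodule ℝ V) := by
  simp [flat, Submodule.mem_iInf]

theorem signVector_eq_zero {x : V} {H : A.hyperplanes} :
    A.signVector x H = 0 ↔ x ∈ (H : Submodule ℝ V) := by
  rw [signVector, sign_eq_zero_iff, A.form_eq_zero_iff H.2]

theorem mem_flat_signVector (x : V) : x ∈ A.flat (A.signVector x) :=
  A.mem_flat.2 fun _ => A.signVector_eq_zero.1

omit [FiniteDimensional ℝ V] in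
theorem flat_mem_intersections (σ : A.hyperplanes → SignType) : A.flat σ ∈ A.intersections := by
  classical
  refine ⟨(Finset.univ.filter fun H => σ H = 0).map (Function.Embedding.subtype _), ?_, ?_⟩
  · intro H hH
    obtain ⟨H, -, rfl⟩ := Finset.mem_map.1 hH
    exact H.2
  · rw [flat, Finset.inf_map, Finset.inf_eq_iInf]
    simp

theorem flat_signVector_le {x : V} {X : Submodule ℝ V} (hX : X ∈ A.intersections) :
    A.flat (A.signVector x) ≤ X ↔ x ∈ X := by
  refine ⟨fun h => h (A.mem_flat_signVector x), fun h => ?_⟩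
  obtain ⟨B, hB, rfl⟩ := hX
  refine Finset.le_inf fun H hH y hy => ?_
  exact A.mem_flat.1 hy ⟨H, hB hH⟩ (A.signVector_eq_zero.2 (Finset.inf_le (f := id) hH h))

omit [FiniteDimensional ℝ V] in
theorem flat_eq_top_iff {σ : A.hyperplanes → SignType} : A.flat σ = ⊤ ↔ ∀ H, σ H ≠ 0 := by
  constructor
  · intro h H h0
    have h1 : A.flat σ ≤ H := fun x hx => A.mem_flat.1 hx H h0
    rw [h, top_le_iff] at h1
    have h2 := A.finrank_add_one H H.2
    rw [h1, finrank_top] at h2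
    omega
  · intro h
    rw [eq_top_iff]
    exact fun x _ => A.mem_flat.2 fun H h0 => absurd h0 (h H)

-- A face lies in X exactly when its flat does, and its dimension is that of its flat; this is the
-- face decomposition of X ∩ K.
open Classical in
theorem sum_faces_le {K : Set V} (hK : IsOpen K) (hc : Convex ℝ K) {X : Submodule ℝ V}
    (hX : X ∈ A.intersections) :
    ∑ σ ∈ Finset.univ.filter (fun σ => σ ∈ A.faces K ∧ A.flat σ ≤ X),
      (-1 : ℤ) ^ Module.finrank ℝ (A.flat σ) =
    if ((X : Set V) ∩ K).Nonempty then (-1) ^ Module.finrank ℝ X else 0 := by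
  have h1 := sum_faceEuler (fun H : A.hyperplanes => (H : Submodule ℝ V).form) hK hc X
  have h2 : convexEuler K X =
      if ((X : Set V) ∩ K).Nonempty then (-1) ^ Module.finrank ℝ X else 0 := rfl
  rw [← h2, ← h1, Finset.sum_filter]
  refine Finset.sum_congr rfl fun σ _ => ?_
  have h3 : (⨅ H : A.hyperplanes, ⨅ _ : σ H = 0, LinearMap.ker (H : Submodule ℝ V).form) =
      A.flat σ := iInf_congr fun H => iInf_congr fun _ => A.ker_form H.2
  rw [faceEuler, h3]
  have h4 : (σ ∈ A.faces K ∧ A.flat σ ≤ X) ↔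
      ∃ x ∈ X, x ∈ K ∧ ∀ i : A.hyperplanes,
        SignType.sign ((i : Submodule ℝ V).form x) = σ i := by
    constructor
    · rintro ⟨⟨x, hx, rfl⟩, h⟩
      exact ⟨x, (A.flat_signVector_le hX).1 h, hx, fun _ => rfl⟩
    · rintro ⟨x, hxX, hx, h⟩
      obtain rfl : A.signVector x = σ := funext h
      exact ⟨⟨x, hx, rfl⟩, (A.flat_signVector_le hX).2 hxX⟩
  by_cases h : σ ∈ A.faces K ∧ A.flat σ ≤ X
  · rw [if_pos h, if_pos (h4.1 h), inf_eq_right.2 h.2]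
  · rw [if_neg h, if_neg fun h' => h (h4.2 h')]

open Classical in
/-- Zaslavsky's formula for an open convex set. -/
theorem ncard_regular_faces {K : Set V} (hK : IsOpen K) (hc : Convex ℝ K) :
    (-1 : ℤ) ^ Module.finrank ℝ V * ({σ | σ ∈ A.faces K ∧ ∀ H, σ H ≠ 0}.ncard : ℤ) =
      ∑ X ∈ Finset.univ.filter (fun X : ↥A.intersections =>
        (X : Submodule ℝ V) ∈ A.interiorIntersections K),
        A.moebius X * (-1) ^ Module.finrank ℝ (X : Submodule ℝ V) := by
  have h1 : ∀ X : ↥A.intersections, (if (X : Submodule ℝ V) ∈ A.interiorIntersections K then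
      A.moebius X * (-1) ^ Module.finrank ℝ (X : Submodule ℝ V) else 0) =
      ∑ σ ∈ Finset.univ.filter (fun σ => σ ∈ A.faces K),
        if A.flat σ ≤ X then A.moebius X * (-1 : ℤ) ^ Module.finrank ℝ (A.flat σ) else 0 := by
    intro X
    have h2 := A.sum_faces_le hK hc X.2
    rw [← Finset.sum_filter, Finset.filter_filter, ← Finset.mul_sum, h2, mul_ite, mul_zero]
    refine if_congr ?_ rfl rfl
    exact ⟨fun h => h.2, fun h => ⟨X.2, h⟩⟩
  rw [Finset.sum_filter, Finset.sum_congr rfl fun X _ => h1 X, Finset.sum_comm]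
  -- After exchanging the sums, each face carries the sum of μ over all X containing its flat, which
  -- is zero unless the flat is V.
  have h3 : ∀ σ, (∑ X : ↥A.intersections,
      if A.flat σ ≤ X then A.moebius X * (-1 : ℤ) ^ Module.finrank ℝ (A.flat σ) else 0) =
      if ∀ H, σ H ≠ 0 then (-1) ^ Module.finrank ℝ V else 0 := by
    intro σ
    have h4 := A.sum_moebius ⟨_, A.flat_mem_intersections σ⟩
    rw [← Finset.sum_filter, ← Finset.sum_mul, h4, ite_mul, one_mul, zero_mul]
    by_cases h : A.flat σ = ⊤
    · rw [if_pos h, if_pos (A.flat_eq_top_iff.1 h), h, finrank_top]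
    · rw [if_neg h, if_neg fun h' => h (A.flat_eq_top_iff.2 h')]
  rw [Finset.sum_congr rfl fun σ _ => h3 σ, ← Finset.sum_filter, Finset.filter_filter,
    Finset.sum_const, nsmul_eq_mul, mul_comm, Set.ncard_eq_toFinset_card']
  congr 3
  ext σ
  simp

/-- The form defining S may be any nonzero multiple of `H.form`; the reference point x in S absorbs
its sign. -/
theorem IsOpenHalfspace.mem_iff {H : Submodule ℝ V} (hH : H ∈ A.hyperplanes) {S : Set V}
    (hS : IsOpenHalfspace H S) {x y : V} (hx : x ∈ S) :
    y ∈ S ↔ SignType.sign (H.form y) = SignType.sign (H.form x) := by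
  obtain ⟨f, hf, rfl⟩ := hS
  obtain ⟨c, hc, h⟩ := LinearMap.exists_eq_smul_of_ker_eq (hf.trans (A.ker_form hH).symm)
  simp only [Set.mem_ofPred_eq, h] at hx ⊢
  rcases lt_or_gt_of_ne hc with hc | hc
  · have h1 : H.form x < 0 := by
      by_contra h
      exact absurd hx (not_lt.2 (mul_nonpos_of_nonpos_of_nonneg hc.le (not_lt.1 h)))
    rw [sign_neg h1, sign_eq_neg_one_iff]
    refine ⟨fun hy => ?_, fun hy => mul_pos_of_neg_of_neg hc hy⟩
    by_contra h
    exact absurd hy (not_lt.2 (mul_nonpos_of_nonpos_of_nonneg hc.le (not_lt.1 h)))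
  · rw [sign_pos ((mul_pos_iff_of_pos_left hc).1 hx), sign_eq_one_iff, mul_pos_iff_of_pos_left hc]

theorem IsCone.mem_of_signVector_eq {K : Set V} (hK : A.IsCone K) {x y : V} (hx : x ∈ K)
    (h : A.signVector y = A.signVector x) : y ∈ K := by
  obtain ⟨-, 𝒮, h𝒮, rfl⟩ := hK
  intro S hS
  obtain ⟨H, hH, hHS⟩ := h𝒮 S hS
  exact (hHS.mem_iff A hH (hx S hS)).2 (congrFun h ⟨H, hH⟩)

omit [FiniteDimensional ℝ V] in
theorem IsCone.convex {K : Set V} (hK : A.IsCone K) : Convex ℝ K := by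
  obtain ⟨-, 𝒮, h𝒮, rfl⟩ := hK
  refine convex_sInter fun S hS => ?_
  obtain ⟨H, -, f, -, rfl⟩ := h𝒮 S hS
  exact convex_halfSpace_gt f.isLinear 0

theorem IsCone.isOpen {K : Set V} (hK : A.IsCone K) : IsOpen K := by
  obtain ⟨⟨x, hx⟩, 𝒮, h𝒮, rfl⟩ := hK
  -- All the halfspaces contain x, so each is determined by its hyperplane.
  have hfin : 𝒮.Finite := by
    refine (A.hyperplanes.finite_toSet.image fun H =>
      {y | SignType.sign (H.form y) = SignType.sign (H.form x)}).subset fun S hS => ?_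
    obtain ⟨H, hH, hHS⟩ := h𝒮 S hS
    refine ⟨H, hH, ?_⟩
    ext y
    exact (hHS.mem_iff A hH (hx S hS)).symm
  refine hfin.isOpen_sInter fun S hS => ?_
  obtain ⟨H, -, f, -, rfl⟩ := h𝒮 S hS
  exact isOpen_lt continuous_const f.continuous_of_finiteDimensional

theorem mem_complement {x : V} : x ∈ A.complement ↔ ∀ H, A.signVector x H ≠ 0 := by
  simp only [complement, Set.mem_compl_iff, Set.mem_iUnion, not_exists, ne_eq, signVector_eq_zero,
    Subtype.forall, SetLike.mem_coe]

theorem convex_signVector_eq {x : V} (hx : x ∈ A.complement) :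
    Convex ℝ {y | A.signVector y = A.signVector x} := by
  have h1 : {y | A.signVector y = A.signVector x} =
      ⋂ H : A.hyperplanes, {y | A.signVector y H = A.signVector x H} := by
    ext y
    simp [funext_iff]
  rw [h1]
  refine convex_iInter fun H => ?_
  have h2 := A.mem_complement.1 hx H
  rcases h3 : A.signVector x H with _ | _ | _
  · exact absurd h3 h2
  · have h4 : {y | A.signVector y H = SignType.neg} = {y | (H : Submodule ℝ V).form y < 0} := by
      ext y
      exact sign_eq_neg_one_iff
    rw [h4]
    exact convex_halfSpace_lt (LinearMap.isLinear _) 0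
  · have h4 : {y | A.signVector y H = SignType.pos} = {y | 0 < (H : Submodule ℝ V).form y} := by
      ext y
      exact sign_eq_one_iff
    rw [h4]
    exact convex_halfSpace_gt (LinearMap.isLinear _) 0

/-- Signs are locally constant off the hyperplanes, hence constant on components; conversely, a
nowhere-zero sign vector cuts out a convex set. -/
theorem connectedComponentIn_complement {x : V} (hx : x ∈ A.complement) :
    connectedComponentIn A.complement x = {y | A.signVector y = A.signVector x} := by
  apply Set.Subset.antisymm
  · intro y hy
    have hsub := connectedComponentIn_subset A.complement x
    have hpre : IsPreconnected (connectedComponentIn A.complement x) :=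
      isPreconnected_connectedComponentIn
    ext H
    have hcont : ContinuousOn (A.signVector · H) (connectedComponentIn A.complement x) := by
      intro z hz
      have h0 : (H : Submodule ℝ V).form z ≠ 0 := fun h =>
        A.mem_complement.1 (hsub hz) H (sign_eq_zero_iff.2 h)
      have h1 : ContinuousAt (H : Submodule ℝ V).form z :=
        (LinearMap.continuous_of_finiteDimensional _).continuousAt
      exact ((continuousAt_sign_of_ne_zero h0).comp h1).continuousWithinAt
    exact hpre.constant hcont hy (mem_connectedComponentIn hx)
  · refine (A.convex_signVector_eq hx).isPreconnected.subset_connectedComponentIn rfl ?_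
    intro y hy
    rw [mem_complement] at hx ⊢
    rw [show A.signVector y = A.signVector x from hy]
    exact hx

theorem chambersIn_eq_image {K : Set V} (hK : A.IsCone K) :
    A.chambersIn K =
      (fun σ => {y | A.signVector y = σ}) '' {σ | σ ∈ A.faces K ∧ ∀ H, σ H ≠ 0} := by
  ext C
  constructor
  · rintro ⟨⟨x, hx, rfl⟩, hC⟩
    exact ⟨A.signVector x, ⟨⟨x, hC (mem_connectedComponentIn hx), rfl⟩, A.mem_complement.1 hx⟩,
      (A.connectedComponentIn_complement hx).symm⟩
  · rintro ⟨_, ⟨⟨x, hx, rfl⟩, h⟩, rfl⟩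
    have hxc := A.mem_complement.2 h
    exact ⟨⟨x, hxc, (A.connectedComponentIn_complement hxc).symm⟩,
      fun y hy => hK.mem_of_signVector_eq A hx hy⟩

theorem finite_chambersIn {K : Set V} (hK : A.IsCone K) : (A.chambersIn K).Finite := by
  rw [A.chambersIn_eq_image hK]
  exact (Set.toFinite _).image _

theorem ncard_chambersIn {K : Set V} (hK : A.IsCone K) :
    (A.chambersIn K).ncard = {σ | σ ∈ A.faces K ∧ ∀ H, σ H ≠ 0}.ncard := by
  rw [A.chambersIn_eq_image hK]
  refine Set.InjOn.ncard_image ?_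
  rintro _ ⟨⟨x, hx, rfl⟩, -⟩ τ - h
  exact ((Set.ext_iff.1 h x).1 rfl)

end HyperplaneArrangement

/-! ### Transverse elements and the conclusion -/

namespace RealReflectionGroup

variable {V : Type*} [NormedAddCommGroup V] [NormedSpace ℝ V] [FiniteDimensional ℝ V]
  {W : Subgroup (V ≃ₗ[ℝ] V)} [Finite W]

open Classical in
/-- Sums over transverse elements, grouped by fixed space. -/
theorem sum_transverseElements (hW : IsGeneratedByReflections W) (K : Set V) {M : Type*}
    [AddCommMonoid M] (φ : Submodule ℝ V → M) :
    ∑ w ∈ (transverseElements W K).toFinite.toFinset, φ (fixedSpace (w : V ≃ₗ[ℝ] V)) =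
      ∑ X ∈ Finset.univ.filter (fun X : ↥(reflectionArrangement W).intersections =>
        (X : Submodule ℝ V) ∈ (reflectionArrangement W).interiorIntersections K),
        ((reflectionArrangement W).moebius X).natAbs • φ X := by
  set F : W → ↥(reflectionArrangement W).intersections :=
    fun w => ⟨fixedSpace (w : V ≃ₗ[ℝ] V), fixedSpace_mem_intersections hW w.2⟩
  rw [← Finset.sum_fiberwise_of_maps_to (g := F) (t := Finset.univ.filter
    fun X : ↥(reflectionArrangement W).intersections =>
      (X : Submodule ℝ V) ∈ (reflectionArrangement W).interiorIntersections K)]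
  · refine Finset.sum_congr rfl fun X hX => ?_
    have h1 : ∀ w ∈ ((transverseElements W K).toFinite.toFinset.filter fun w => F w = X),
        φ (fixedSpace (w : V ≃ₗ[ℝ] V)) = φ X := by
      intro w hw
      rw [← (Finset.mem_filter.1 hw).2]
    rw [Finset.sum_congr rfl h1, Finset.sum_const, moebius_eq_sum hW, Int.natAbs_mul,
      Int.natAbs_pow, Int.natAbs_neg, Int.natAbs_one, one_pow, one_mul, Int.natAbs_natCast,
      Set.ncard_eq_toFinset_card _]
    congr 2
    ext w
    simp only [Finset.mem_filter, Finset.mem_univ, true_and, Set.Finite.mem_toFinset,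
      Set.mem_ofPred_eq, F, Subtype.ext_iff] at hX ⊢
    refine ⟨fun h => h.2, fun h => ⟨?_, h⟩⟩
    rw [transverseElements, Set.mem_ofPred_eq, h]
    exact hX
  · intro w hw
    exact Finset.mem_filter.2 ⟨Finset.mem_univ _, (transverseElements W K).toFinite.mem_toFinset.1 hw⟩

end RealReflectionGroup

theorem mainTheorem6 (n : ℕ)
    (W : Subgroup (EuclideanSpace ℝ (Fin n) ≃ₗ[ℝ] EuclideanSpace ℝ (Fin n))) [Finite W]
    (hW : RealReflectionGroup.IsGeneratedByReflections W)
    (K : Set (EuclideanSpace ℝ (Fin n)))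
    (hK : (RealReflectionGroup.reflectionArrangement W).IsCone K) :
    (RealReflectionGroup.reflectionArrangement W).poincare K =
        ∑ w ∈ (RealReflectionGroup.transverseElements W K).toFinite.toFinset,
          (Polynomial.X : Polynomial ℕ) ^
            (n - Module.finrank ℝ (RealReflectionGroup.fixedSpace (w : EuclideanSpace ℝ (Fin n) ≃ₗ[ℝ] EuclideanSpace ℝ (Fin n)))) ∧
      ((RealReflectionGroup.reflectionArrangement W).chambersIn K).Finite ∧
      ((RealReflectionGroup.reflectionArrangement W).chambersIn K).ncard =
        (RealReflectionGroup.transverseElements W K).ncard := by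
  classical
  set A := RealReflectionGroup.reflectionArrangement W with hA
  refine ⟨?_, A.finite_chambersIn hK, ?_⟩
  · rw [RealReflectionGroup.sum_transverseElements hW K
      (fun X => (Polynomial.X : Polynomial ℕ) ^ (n - Module.finrank ℝ X)),
      ← Finset.sum_fiberwise_of_maps_to
        (g := fun X : ↥A.intersections => n - Module.finrank ℝ (X : Submodule ℝ (EuclideanSpace ℝ (Fin n))))
        (t := Finset.range (n + 1))
        fun X _ => Finset.mem_range.2 (Nat.lt_succ_of_le (Nat.sub_le _ _)),
      HyperplaneArrangement.poincare, finrank_euclideanSpace_fin]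
    refine Finset.sum_congr rfl fun k _ => ?_
    rw [HyperplaneArrangement.whitney, finrank_euclideanSpace_fin, Finset.filter_filter, map_sum,
      Finset.sum_mul]
    refine Finset.sum_congr rfl fun X hX => ?_
    rw [(Finset.mem_filter.1 hX).2.2, nsmul_eq_mul]
    rfl
  · rw [A.ncard_chambersIn hK]
    have h1 := A.ncard_regular_faces hK.isOpen hK.convex
    have h2 := RealReflectionGroup.sum_transverseElements hW K (fun _ => (1 : ℤ))
    rw [Finset.sum_const, nsmul_one, ← Set.ncard_eq_toFinset_card] at h2
    rw [← Int.natCast_inj, h2]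
    -- Restoring the factor (-1)^n matches Zaslavsky's formula term by term: μ(V, X) has sign (-1)^d
    -- with d = codim X, and n = dim X + d.
    apply mul_left_cancel₀ (pow_ne_zero (Module.finrank ℝ (EuclideanSpace ℝ (Fin n)))
      (show (-1 : ℤ) ≠ 0 by norm_num))
    rw [h1, Finset.mul_sum]
    refine Finset.sum_congr rfl fun X _ => ?_
    obtain ⟨d, hd⟩ := Nat.exists_eq_add_of_le (Submodule.finrank_le (X : Submodule ℝ (EuclideanSpace ℝ (Fin n))))
    rw [RealReflectionGroup.moebius_eq_sum hW, Int.natAbs_mul,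
      Int.natAbs_pow, Int.natAbs_neg, Int.natAbs_one, one_pow, one_mul, Int.natAbs_natCast, hd,
      Nat.add_sub_cancel_left, pow_add, nsmul_one]
    ring
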